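/- **Setting.** Let $(\Lambda,\le)$ be a finite partially ordered set. $\mathcal{M}f$ is the category of nonempty smooth ($C^\infty$) manifolds (Hausdorff, second countable, pure finite dimension, no boundary) and smooth maps; $\mathcal{FM}$ is the category of fibered manifolds (surjective submersions $Y\to M$) and fiber respecting smooth maps. A *multifibered manifold* $\pi=(M_\alpha,\pi^\beta_\alpha,\Lambda,M)$ is a projective system over $\Lambda$ of manifolds $M_\alpha$ and surjective submersions $\pi^\beta_\alpha:M_\beta\to M_\alpha$ ($\alpha\le\beta$), whose projective limit $M=\varprojlim M_\alpha$ is a manifold with surjective submersions $\pi_\alpha:M\to M_\alpha$, such that for some $n$ and some map $p:\{1,\dots,n\}\to\Lambda$ (not necessarily surjective) there are, around every $x\in M$, centered charts $h$ of $M$ at $x$ with values in $\mathbb R^n$ and $h_\alpha$ of $M_\alpha$ at $\pi_\alpha(x)$ with values in $\mathbb R^{\{i\,:\,p(i)\le\alpha\}}$ for which $h_\alpha\circ\pi_\alpha=\mathrm{pr}_\alpha\circ h$, where $\mathrm{pr}_\alpha$ is the coordinate projection. A *multifibered map* $f:\pi\to\bar\pi$ is a family of smooth maps $f_\alpha:M_\alpha\to\bar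 M_\alpha$ with $\bar\pi^\beta_\alpha f_\beta=f_\alpha\pi^\beta_\alpha$; it induces a smooth map $M\to\bar M$. This gives the category $\mathcal{FM}_\Lambda$. A *bundle functor* $F:\mathcal{FM}_\Lambda\to\mathcal{FM}$ is a functor for which $F(\pi)$ is a fibered manifold over $M$ and $F(f)$ lies over the map $M\to\bar M$ induced by $f$, and which is local: if $f:\pi'\to\pi$ is the inclusion of an open multifibered submanifold (all $f_\alpha$ are diffeomorphisms onto open subsets) with limit $U\subset M$, then $F(f)$ is a diffeomorphism of $F(\pi')$ onto the part of $F(\pi)$ over $U$. It is *product preserving* if it preserves binary products. For a manifold $X$ and $\alpha\in\Lambda$ let $i_\alpha(X)=(X_\gamma)$ be the multifibered manifold with limit $X$, where $X_\gamma=X$ if $\gamma\ge\alpha$, $X_\gamma=pt$ (a point) otherwise, and the projections are identities or maps to the point. A smooth map $X\to Y$ is a multifibered map $i_\alpha(X)\to i_\beta(Y)$ for $\alpha\le\beta$; so $i_\alpha:\mathcal{M}f\to\mathcal{FM}_\Lambda$ is a functor, and $\mathrm{id}^\alpha_\beta:i_\alpha\to i_\beta$, given by $\mathrm{id}_X$,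 is a natural transformation. Put $G^F_\alpha=F\circ i_\alpha$ and $(\mu^F)^\alpha_\beta=F(\mathrm{id}^\alpha_\beta):G^F_\alpha\to G^F_\beta$. For a natural transformation $\eta:F\to\bar F$ put $\nu^\eta_\alpha(X)=\eta_{i_\alpha(X)}$. Let $\mu=(\mu^\alpha_\beta:G_\alpha\to G_\beta)$ be an inductive system over $\Lambda$ of natural transformations of functors $\mathcal{M}f\to\mathcal{FM}$ such that each $G_\alpha(pt)$ is a point; $\mu=\mu^F$ is such a system if $F$ is product preserving. Let $$\textstyle\prod_\mu G_\alpha(\pi)=\{(x_\alpha)\in\prod_\alpha G_\alpha(M_\alpha)\;:\;G_\beta(\pi^\beta_\alpha)(x_\beta)=\mu^\alpha_\beta(M_\alpha)(x_\alpha)\ \text{for}\ \alpha\le\beta\}.$$ The projection to the component $\alpha$ is a bijection $\mathcal O_\alpha(X):\prod_\mu G_\gamma(i_\alpha(X))\to G_\alpha(X)$. Let $T^\mu(\pi)=G_\alpha(X)$ if $\pi=i_\alpha(X)$ for some $\alpha,X$ (fix one such representation for each such $\pi$, the same for all $\mu$), and $T^\mu(\pi)=\prod_\mu G_\alpha(\pi)$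 otherwise; let $I_\pi:T^\mu(\pi)\to\prod_\mu G_\alpha(\pi)$ be $\mathcal O_\alpha(X)^{-1}$ in the first case and the identity in the second. A family $\nu=(\nu_\alpha:G_\alpha\to\bar G_\alpha)$ of natural transformations with $\bar\mu^\alpha_\beta(X)\circ\nu_\alpha(X)=\nu_\beta(X)\circ\mu^\alpha_\beta(X)$ for all $\alpha\le\beta$ and all $X$ (*compatible* with $\mu$, $\bar\mu$) induces $\tilde\nu_\pi=\bar I_\pi^{-1}\circ\prod_\alpha\nu_\alpha(M_\alpha)\circ I_\pi:T^\mu(\pi)\to T^{\bar\mu}(\pi)$. Finally let $j_\alpha:\pi\to i_\alpha(M_\alpha)$ be the multifibered map with components $\pi^\gamma_\alpha$ for $\gamma\ge\alpha$ and the map to the point otherwise, let $\Theta_\pi=(F(j_\alpha))_\alpha:F(\pi)\to\prod_{\mu^F}G^F_\alpha(\pi)$, and let $\kappa_\pi=I_\pi^{-1}\circ\Theta_\pi:F(\pi)\to T^{\mu^F}(\pi)$. Write $\bar\kappa$ for the corresponding maps for a second functor $\bar F$. **Proposition 3.3.** Let $F,\bar F:\mathcal{FM}_\Lambda\to\mathcal{FM}$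 be product preserving bundle functors, and let $\nu=(\nu_\alpha:G^F_\alpha\to G^{\bar F}_\alpha)_{\alpha\in\Lambda}$ be a family of natural transformations compatible with $\mu^F$ and $\mu^{\bar F}$. Then every $\bar\kappa_\pi$ is a diffeomorphism (that is, it is bijective, and $\bar I_\pi\circ\bar\kappa_\pi$ is a smooth embedding of $\bar F(\pi)$ into $\prod_\alpha G^{\bar F}_\alpha(M_\alpha)$), the maps $$\eta_\pi=\bar\kappa_\pi^{-1}\circ\tilde\nu_\pi\circ\kappa_\pi:F(\pi)\to\bar F(\pi)$$ form a natural transformation $\eta:F\to\bar F$ with $\nu^\eta_\alpha=\nu_\alpha$ for all $\alpha\in\Lambda$, and $\eta$ is the only natural transformation $F\to\bar F$ with this property. -/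

import Mathlib

open CategoryTheory
open scoped Manifold ContDiff

noncomputable section

namespace Multifibered

/-! ### Smooth manifolds and fibered manifolds -/

/-- A nonempty smooth (`C^∞`) manifold without boundary: Hausdorff, second countable, of pure
finite dimension. -/
structure Mf where
  carrier : Type
  dim : ℕ
  [top : TopologicalSpace carrier]
  [charted : ChartedSpace (EuclideanSpace ℝ (Fin dim)) carrier]
  [smooth : IsManifold (𝓡 dim) ∞ carrier]
  [t2 : T2Space carrier]
  [secondCountable : SecondCountableTopology carrier]
  [nonempty : Nonempty carrier]

namespace Mf

instance : CoeSort Mf Type := ⟨Mf.carrier⟩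

attribute [instance] Mf.top Mf.charted Mf.smooth Mf.t2 Mf.secondCountable Mf.nonempty

/-- Smooth maps. -/
@[ext]
structure Hom (X Y : Mf) where
  toFun : X → Y
  smooth : ContMDiff (𝓡 X.dim) (𝓡 Y.dim) ∞ toFun

/-- The category of smooth manifolds and smooth maps. -/
instance : Category Mf where
  Hom := Hom
  id X := ⟨id, contMDiff_id⟩
  comp f g := ⟨g.toFun ∘ f.toFun, g.smooth.comp f.smooth⟩

@[ext]
theorem hom_ext {X Y : Mf} {f g : X ⟶ Y} (h : ∀ x, f.toFun x = g.toFun x) : f = g :=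
  Hom.ext (funext h)

@[simp]
theorem id_toFun (X : Mf) (x : X) : Hom.toFun (𝟙 X) x = x := rfl

@[simp]
theorem comp_toFun {X Y Z : Mf} (f : X ⟶ Y) (g : Y ⟶ Z) (x : X) :
    Hom.toFun (f ≫ g) x = g.toFun (f.toFun x) := rfl

/-- A surjective submersion: surjective, with surjective differential at every point. -/
structure IsSurjSubmersion {X Y : Mf} (f : X ⟶ Y) : Prop where
  surjective : Function.Surjective f.toFun
  submersion : ∀ x, Function.Surjective (mfderiv (𝓡 X.dim) (𝓡 Y.dim) f.toFun x)

/-- A diffeomorphism onto an open subset: an injective local diffeomorphism. -/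
structure IsOpenEmb {X Y : Mf} (f : X ⟶ Y) : Prop where
  injective : Function.Injective f.toFun
  localDiffeo : IsLocalDiffeomorph (𝓡 X.dim) (𝓡 Y.dim) ∞ f.toFun

/-- A smooth chart on `X` with values in a normed space `E`: a diffeomorphism between open
subsets of `X` and of `E`. -/
structure IsSmoothChart (X : Mf) {E : Type} [NormedAddCommGroup E] [NormedSpace ℝ E]
    (φ : OpenPartialHomeomorph X E) : Prop where
  smooth : ContMDiffOn (𝓡 X.dim) 𝓘(ℝ, E) ∞ φ φ.source
  smooth_symm : ContMDiffOn 𝓘(ℝ, E) (𝓡 X.dim) ∞ φ.symm φ.target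

/-- The one-point manifold. -/
def pt : Mf where
  carrier := EuclideanSpace ℝ (Fin 0)
  dim := 0

instance : Subsingleton pt.carrier :=
  inferInstanceAs (Subsingleton (EuclideanSpace ℝ (Fin 0)))

/-- The constant map. -/
def const (X : Mf) {Y : Mf} (y : Y) : X ⟶ Y := ⟨fun _ => y, contMDiff_const⟩

/-- The unique map to the one-point manifold. -/
def toPt (X : Mf) : X ⟶ pt := const X (0 : EuclideanSpace ℝ (Fin 0))

/-- `X` if `b` holds, and the one-point manifold otherwise. -/
def sel (X : Mf) : Bool → Mf
  | true => X
  | false => pt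

/-- The identity map `sel X b ⟶ X`, available when `b` holds. -/
def outSel {X : Mf} : {b : Bool} → b = true → (sel X b ⟶ X)
  | true, _ => 𝟙 X
  | false, h => absurd h (by decide)

/-- A map into `sel X b`: the given map into `X` if `b` holds, the map to the point otherwise. -/
def intoSel {Y X : Mf} : (b : Bool) → (b = true → (Y ⟶ X)) → (Y ⟶ sel X b)
  | true, f => f rfl
  | false, _ => toPt Y

theorem sel_hom_ext {Y X : Mf} {b : Bool} {f g : Y ⟶ sel X b}
    (h : ∀ hb : b = true, f ≫ outSel hb = g ≫ outSel hb) : f = g := by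
  cases b with
  | true => exact h rfl
  | false => exact hom_ext fun x => Subsingleton.elim (α := pt.carrier) _ _

@[simp]
theorem intoSel_outSel {Y X : Mf} {b : Bool} (f : b = true → (Y ⟶ X)) (hb : b = true) :
    intoSel b f ≫ outSel hb = f hb := by
  subst hb
  exact Category.comp_id _

@[simp]
theorem intoSel_outSel_assoc {Y X Z : Mf} {b : Bool} (f : b = true → (Y ⟶ X)) (hb : b = true)
    (g : X ⟶ Z) : intoSel b f ≫ outSel hb ≫ g = f hb ≫ g := by
  rw [← Category.assoc, intoSel_outSel]

theorem comp_intoSel_outSel {W Y X : Mf} {b : Bool} (k : W ⟶ Y) (f : b = true → (Y ⟶ X))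
    (hb : b = true) : (k ≫ intoSel b f) ≫ outSel hb = k ≫ f hb := by
  rw [Category.assoc, intoSel_outSel]

end Mf

/-- A fibered manifold: a surjective submersion of manifolds. -/
structure FM where
  total : Mf
  base : Mf
  proj : total ⟶ base
  isSurjSubmersion : Mf.IsSurjSubmersion proj

namespace FM

/-- A morphism of fibered manifolds: a fiber respecting smooth map, with its base map. -/
@[ext]
structure Hom (Y Z : FM) where
  total : Y.total ⟶ Z.total
  base : Y.base ⟶ Z.base
  comm : total ≫ Z.proj = Y.proj ≫ base

/-- The category of fibered manifolds. -/
instance : Category FM where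
  Hom := Hom
  id Y := ⟨𝟙 _, 𝟙 _, by simp⟩
  comp f g := ⟨f.total ≫ g.total, f.base ≫ g.base, by
    rw [Category.assoc, g.comm, ← Category.assoc, f.comm, Category.assoc]⟩

@[ext]
theorem hom_ext {Y Z : FM} {f g : Y ⟶ Z} (h₁ : f.total = g.total) (h₂ : f.base = g.base) :
    f = g := Hom.ext h₁ h₂

@[simp]
theorem id_total (Y : FM) : Hom.total (𝟙 Y) = 𝟙 Y.total := rfl

@[simp]
theorem id_base (Y : FM) : Hom.base (𝟙 Y) = 𝟙 Y.base := rfl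

@[simp]
theorem comp_total {X Y Z : FM} (f : X ⟶ Y) (g : Y ⟶ Z) :
    Hom.total (f ≫ g) = f.total ≫ g.total := rfl

@[simp]
theorem comp_base {X Y Z : FM} (f : X ⟶ Y) (g : Y ⟶ Z) :
    Hom.base (f ≫ g) = f.base ≫ g.base := rfl

/-- The base functor. -/
def baseFunctor : FM ⥤ Mf where
  obj Y := Y.base
  map f := f.base

end FM

/-! ### Multifibered manifolds -/

variable (Λ : Type) [PartialOrder Λ]

open Classical in
/-- A multifibered manifold over `Λ`: a projective system of manifolds `comp α` and surjective
submersions whose limit `total` is a manifold with surjective submersions `can α`, and which is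
locally modelled on the projective system of the coordinate spaces
`L_α = ℝ^{i | p i ≤ α}` with limit `L = ℝ^n`, for some `p : {1, …, n} → Λ`. -/
structure MFib where
  comp : Λ → Mf
  proj : ∀ {α β : Λ}, α ≤ β → (comp β ⟶ comp α)
  proj_self : ∀ α, proj (le_refl α) = 𝟙 (comp α)
  proj_comp : ∀ {α β γ : Λ} (h : α ≤ β) (h' : β ≤ γ), proj h' ≫ proj h = proj (h.trans h')
  total : Mf
  can : ∀ α, total ⟶ comp α
  can_proj : ∀ {α β : Λ} (h : α ≤ β), can β ≫ proj h = can α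
  /-- `total` is the set-theoretic projective limit. -/
  limit : ∀ x : (∀ α, comp α), (∀ {α β : Λ} (h : α ≤ β), (proj h).toFun (x β) = x α) →
    ∃! y : total, ∀ α, (can α).toFun y = x α
  proj_submersion : ∀ {α β : Λ} (h : α ≤ β), Mf.IsSurjSubmersion (proj h)
  can_submersion : ∀ α, Mf.IsSurjSubmersion (can α)
  /-- Around every point there are centered charts `φ` on `total` and `ψ α` on `comp α` in which
  `can α` is the coordinate projection `L → L_α`. -/
  locally_model : ∃ (n : ℕ) (p : Fin n → Λ), ∀ x : total,
    ∃ (φ : OpenPartialHomeomorph total (Fin n → ℝ))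
      (ψ : ∀ α, OpenPartialHomeomorph (comp α) ({i : Fin n // p i ≤ α} → ℝ)),
      total.IsSmoothChart (E := Fin n → ℝ) φ ∧ x ∈ φ.source ∧ φ x = 0 ∧
      ∀ α, (comp α).IsSmoothChart (E := {i : Fin n // p i ≤ α} → ℝ) (ψ α) ∧ (can α).toFun x ∈ (ψ α).source ∧
        ψ α ((can α).toFun x) = 0 ∧
        ∀ y ∈ φ.source, (can α).toFun y ∈ (ψ α).source ∧
          ∀ i : {i : Fin n // p i ≤ α}, ψ α ((can α).toFun y) i = φ y i

namespace MFib

variable {Λ}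

/-- A multifibered map: a family of smooth maps commuting with the projections, together with the
smooth map which it determines on the limits. -/
@[ext]
structure Hom (π ρ : MFib Λ) where
  comp : ∀ α, π.comp α ⟶ ρ.comp α
  comm : ∀ {α β : Λ} (h : α ≤ β), comp β ≫ ρ.proj h = π.proj h ≫ comp α
  total : π.total ⟶ ρ.total
  total_can : ∀ α, total ≫ ρ.can α = π.can α ≫ comp α

/-- The category of multifibered manifolds over `Λ`. -/
instance : Category (MFib Λ) where
  Hom := Hom
  id π := ⟨fun _ => 𝟙 _, by simp, 𝟙 _, by simp⟩
  comp f g := ⟨fun α => f.comp α ≫ g.comp α, fun h => by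
    rw [Category.assoc, g.comm, ← Category.assoc, f.comm, Category.assoc],
    f.total ≫ g.total, fun α => by
    rw [Category.assoc, g.total_can, ← Category.assoc, f.total_can, Category.assoc]⟩

@[simp]
theorem id_comp' (π : MFib Λ) (α : Λ) : Hom.comp (𝟙 π) α = 𝟙 (π.comp α) := rfl

@[simp]
theorem id_total (π : MFib Λ) : Hom.total (𝟙 π) = 𝟙 π.total := rfl

@[simp]
theorem comp_comp {π ρ σ : MFib Λ} (f : π ⟶ ρ) (g : ρ ⟶ σ) (α : Λ) :
    Hom.comp (f ≫ g) α = f.comp α ≫ g.comp α := rfl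

@[simp]
theorem comp_total {π ρ σ : MFib Λ} (f : π ⟶ ρ) (g : ρ ⟶ σ) :
    Hom.total (f ≫ g) = f.total ≫ g.total := rfl

/-- The map of the limits is determined by the components. -/
theorem hom_ext {π ρ : MFib Λ} {f g : π ⟶ ρ} (h : ∀ α, f.comp α = g.comp α) : f = g := by
  have h₁ : f.comp = g.comp := funext h
  refine Hom.ext h₁ (Mf.hom_ext fun x => ?_)
  have hc : ∀ {α β : Λ} (h : α ≤ β), (ρ.proj h).toFun ((ρ.can β).toFun (f.total.toFun x)) =
      (ρ.can α).toFun (f.total.toFun x) := fun {α β} h =>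
    congrArg (fun k => Mf.Hom.toFun k (f.total.toFun x)) (ρ.can_proj h)
  refine (ρ.limit (fun α => (ρ.can α).toFun (f.total.toFun x)) hc).unique (fun _ => rfl)
    fun α => ?_
  have e : g.total ≫ ρ.can α = f.total ≫ ρ.can α := by
    rw [g.total_can, f.total_can, h α]
  exact congrArg (fun k => Mf.Hom.toFun k x) e

end MFib

/-- The functor sending a multifibered manifold to its limit manifold. -/
def totalFunctor : MFib Λ ⥤ Mf where
  obj π := π.total
  map f := f.total

/-! ### Bundle functors -/

/-- A bundle functor on multifibered manifolds: a functor to fibered manifolds such that the base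
of the value at `π` is the limit manifold of `π` (and likewise for morphisms), which is local: it
sends the inclusion of an open multifibered submanifold over `U` to a diffeomorphism onto the part
of the total space lying over `U`. -/
structure BundleFunctor where
  /-- The total spaces. -/
  tot : MFib Λ ⥤ Mf
  /-- The bundle projections. -/
  proj : tot ⟶ totalFunctor Λ
  proj_submersion : ∀ π, Mf.IsSurjSubmersion (proj.app π)
  locality : ∀ {π ρ : MFib Λ} (f : π ⟶ ρ), (∀ α, Mf.IsOpenEmb (f.comp α)) →
    Mf.IsOpenEmb (tot.map f) ∧
      Set.range (tot.map f).toFun = (proj.app ρ).toFun ⁻¹' Set.range f.total.toFun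

namespace BundleFunctor

variable {Λ}

/-- The functor to fibered manifolds. -/
def functor (F : BundleFunctor Λ) : MFib Λ ⥤ FM where
  obj π := ⟨F.tot.obj π, π.total, F.proj.app π, F.proj_submersion π⟩
  map f := ⟨F.tot.map f, f.total, F.proj.naturality f⟩
  map_id π := FM.hom_ext (F.tot.map_id π) rfl
  map_comp f g := FM.hom_ext (F.tot.map_comp f g) rfl

theorem functor_base (F : BundleFunctor Λ) :
    F.functor ⋙ FM.baseFunctor = totalFunctor Λ := rfl

/-- `F` preserves (binary) products. -/
def ProductPreserving (F : BundleFunctor Λ) : Prop :=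
  Limits.PreservesLimitsOfShape (Discrete Limits.WalkingPair) F.functor

end BundleFunctor

/-! ### The multifibered manifolds `i_α(X)` -/

variable {Λ}

open Classical in
/-- `α ≤ γ`, as a Boolean. -/
def leB (α γ : Λ) : Bool := decide (α ≤ γ)

theorem leB_iff {α γ : Λ} : leB α γ = true ↔ α ≤ γ := by simp [leB]

theorem leB_trans {α β γ : Λ} (h : leB α β = true) (h' : β ≤ γ) : leB α γ = true :=
  leB_iff.2 ((leB_iff.1 h).trans h')

theorem leB_mono {α β γ : Λ} (h : α ≤ β) (h' : leB β γ = true) : leB α γ = true :=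
  leB_iff.2 (h.trans (leB_iff.1 h'))

namespace Mf

theorem isSurjSubmersion_id (X : Mf) : IsSurjSubmersion (𝟙 X) where
  surjective x := ⟨x, rfl⟩
  submersion x := by
    change Function.Surjective (mfderiv (𝓡 X.dim) (𝓡 X.dim) (@id X) x)
    rw [mfderiv_id]
    exact fun v => ⟨v, rfl⟩

theorem isSurjSubmersion_toPt {X : Mf} (f : X ⟶ pt) : IsSurjSubmersion f where
  surjective _ := ⟨Classical.arbitrary X, Subsingleton.elim (α := pt.carrier) _ _⟩
  submersion _ _ := ⟨0, Subsingleton.elim (α := EuclideanSpace ℝ (Fin 0)) _ _⟩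

theorem isSurjSubmersion_intoSel {X : Mf} (b c : Bool) (h : c = true → b = true) :
    IsSurjSubmersion (intoSel c fun hc => (outSel (h hc) : sel X b ⟶ X)) := by
  cases c with
  | false => exact isSurjSubmersion_toPt _
  | true =>
    obtain rfl := h rfl
    exact isSurjSubmersion_id X

theorem isSurjSubmersion_intoSel_id {X : Mf} (c : Bool) :
    IsSurjSubmersion (intoSel c fun _ => 𝟙 X) := by
  cases c with
  | false => exact isSurjSubmersion_toPt _
  | true => exact isSurjSubmersion_id X

/-- Centered charts, with values in any linear model of the right dimension. -/
theorem exists_chart (X : Mf) {E : Type} [NormedAddCommGroup E] [NormedSpace ℝ E]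
    (e : EuclideanSpace ℝ (Fin X.dim) ≃L[ℝ] E) (x : X) :
    ∃ φ : OpenPartialHomeomorph X E, X.IsSmoothChart φ ∧
      φ.source = (chartAt (EuclideanSpace ℝ (Fin X.dim)) x).source ∧
      ∀ y, φ y = e (chartAt (EuclideanSpace ℝ (Fin X.dim)) x y -
        chartAt (EuclideanSpace ℝ (Fin X.dim)) x x) := by
  set c := chartAt (EuclideanSpace ℝ (Fin X.dim)) x with hc
  let t : EuclideanSpace ℝ (Fin X.dim) ≃ₜ E :=
    (Homeomorph.addRight (-(c x))).trans e.toHomeomorph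
  have ht : ∀ v, t v = e (v - c x) := fun v => by
    simp [t, Homeomorph.trans_apply, sub_eq_add_neg]
  have hts : ∀ v, t.symm v = e.symm v + c x := fun v => by
    rw [Homeomorph.symm_apply_eq, ht]; simp
  refine ⟨c.trans t.toOpenPartialHomeomorph, ⟨?_, ?_⟩, by simp, fun y => ?_⟩
  · have h1 : ContMDiffOn (𝓡 X.dim) (𝓡 X.dim) ∞ c c.source := contMDiffOn_chart
    have h2 : ContMDiff (𝓡 X.dim) 𝓘(ℝ, E) ∞ (t : EuclideanSpace ℝ (Fin X.dim) → E) := by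
      rw [contMDiff_iff_contDiff]
      rw [show (t : EuclideanSpace ℝ (Fin X.dim) → E) = fun v => e (v - c x) from funext ht]
      exact e.contDiff.comp (contDiff_id.sub contDiff_const)
    refine (h2.comp_contMDiffOn h1).mono ?_
    simp
  · have h1 : ContMDiffOn (𝓡 X.dim) (𝓡 X.dim) ∞ c.symm c.target := contMDiffOn_chart_symm
    have h2 : ContMDiff 𝓘(ℝ, E) (𝓡 X.dim) ∞ (t.symm : E → EuclideanSpace ℝ (Fin X.dim)) := by
      rw [contMDiff_iff_contDiff]
      rw [show (t.symm : E → EuclideanSpace ℝ (Fin X.dim)) = fun v => e.symm v + c x from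
        funext hts]
      exact e.symm.contDiff.add contDiff_const
    refine h1.comp h2.contMDiffOn ?_
    intro v hv
    simpa using hv
  · exact ht _

end Mf

open Classical in
/-- The multifibered manifold `i_α(X)`: `X` at all `γ ≥ α` and a point elsewhere. -/
def iObj (α : Λ) (X : Mf) : MFib Λ where
  comp γ := Mf.sel X (leB α γ)
  proj {γ δ} h := Mf.intoSel (leB α γ) fun hγ => Mf.outSel (leB_trans hγ h)
  proj_self γ := Mf.sel_hom_ext fun hb => by simp
  proj_comp h h' := Mf.sel_hom_ext fun hb => by simp
  total := X
  can γ := Mf.intoSel (leB α γ) fun _ => 𝟙 X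
  can_proj h := Mf.sel_hom_ext fun hb => by simp
  limit x hx := by
    have hα : leB α α = true := leB_iff.2 le_rfl
    refine ⟨(Mf.outSel hα).toFun (x α), fun γ => ?_, fun y hy => ?_⟩
    · have key : ∀ b (hb : leB α γ = b) (z : Mf.sel X b),
          (∀ h : b = true, (Mf.outSel h).toFun z = (Mf.outSel hα).toFun (x α)) →
          (Mf.intoSel b fun _ => 𝟙 X).toFun ((Mf.outSel hα).toFun (x α)) = z := by
        intro b _ z hz
        cases b with
        | true => exact (hz rfl).symm
        | false => exact Subsingleton.elim (α := Mf.pt.carrier) _ _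
      refine key _ rfl (x γ) fun h => ?_
      have h1 := hx (leB_iff.1 h)
      have h2 := congrArg (Mf.outSel hα).toFun h1
      rw [← Mf.comp_toFun, Mf.intoSel_outSel] at h2
      exact h2
    · rw [← hy α, ← Mf.comp_toFun, Mf.intoSel_outSel]
      rfl
  proj_submersion h := Mf.isSurjSubmersion_intoSel _ _ _
  can_submersion γ := Mf.isSurjSubmersion_intoSel_id _
  locally_model := by
    refine ⟨X.dim, fun _ => α, fun x => ?_⟩
    let e : EuclideanSpace ℝ (Fin X.dim) ≃L[ℝ] (Fin X.dim → ℝ) := EuclideanSpace.equiv _ ℝ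
    obtain ⟨φ, hφ, hφs, hφe⟩ := X.exists_chart e x
    have hx : x ∈ φ.source := by rw [hφs]; exact mem_chart_source _ x
    have key : ∀ γ, ∀ b (_ : leB α γ = b),
        ∃ ψ : OpenPartialHomeomorph (Mf.sel X b) ({i : Fin X.dim // α ≤ γ} → ℝ),
          (Mf.sel X b).IsSmoothChart (E := {i : Fin X.dim // α ≤ γ} → ℝ) ψ ∧ ∀ y ∈ φ.source,
            (Mf.intoSel b fun _ => 𝟙 X).toFun y ∈ ψ.source ∧
            ∀ i : {i : Fin X.dim // α ≤ γ},
              ψ ((Mf.intoSel b fun _ => 𝟙 X).toFun y) i = φ y i := by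
      intro γ b hb
      cases b with
      | true =>
        have hle : α ≤ γ := leB_iff.1 hb
        let r : (Fin X.dim → ℝ) ≃L[ℝ] ({i : Fin X.dim // α ≤ γ} → ℝ) :=
          (LinearEquiv.funCongrLeft ℝ ℝ
            (Equiv.subtypeUnivEquiv fun _ => hle)).toContinuousLinearEquiv
        obtain ⟨ψ, hψ, hψs, hψe⟩ := X.exists_chart (e.trans r) x
        refine ⟨ψ, hψ, fun y hy => ⟨?_, fun i => ?_⟩⟩
        · change y ∈ ψ.source
          rwa [hψs, ← hφs]
        · change ψ y i = φ y i
          rw [hψe, hφe]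
          rfl
      | false =>
        have hle : ¬ α ≤ γ := fun h => by simp [leB_iff.2 h] at hb
        have : IsEmpty {i : Fin X.dim // α ≤ γ} := ⟨fun i => hle i.2⟩
        let r : EuclideanSpace ℝ (Fin 0) ≃L[ℝ] ({i : Fin X.dim // α ≤ γ} → ℝ) :=
          { toFun := fun _ => 0
            invFun := fun _ => 0
            map_add' := fun _ _ => (add_zero 0).symm
            map_smul' := fun c _ => (smul_zero c).symm
            left_inv := fun _ => Subsingleton.elim _ _
            right_inv := fun _ => Subsingleton.elim _ _
            continuous_toFun := continuous_const
            continuous_invFun := continuous_const }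
        let x₀ : Mf.pt := (0 : EuclideanSpace ℝ (Fin 0))
        obtain ⟨ψ, hψ, hψs, hψe⟩ := Mf.pt.exists_chart r x₀
        refine ⟨ψ, hψ, fun y hy => ⟨?_, fun i => isEmptyElim i⟩⟩
        rw [hψs]
        have : (Mf.intoSel false fun _ => 𝟙 X).toFun y = x₀ :=
          Subsingleton.elim (α := Mf.pt.carrier) _ _
        rw [this]
        exact mem_chart_source _ x₀
    choose ψ hψ hψ' using fun γ => key γ _ rfl
    have hx0 : φ x = 0 := by rw [hφe]; simp
    refine ⟨φ, ψ, hφ, hx, hx0, fun γ => ⟨hψ γ, (hψ' γ x hx).1, funext fun i => ?_, hψ' γ⟩⟩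
    exact ((hψ' γ x hx).2 i).trans (by rw [hx0]; rfl)

/-- A map `X ⟶ Y`, viewed as a multifibered map `i_α(X) ⟶ i_β(Y)` for `α ≤ β`. -/
def iMap {α β : Λ} (h : α ≤ β) {X Y : Mf} (f : X ⟶ Y) : iObj α X ⟶ iObj β Y where
  comp γ := Mf.intoSel (leB β γ) fun hγ => Mf.outSel (leB_mono h hγ) ≫ f
  comm _ := Mf.sel_hom_ext fun hb => by simp [iObj]
  total := f
  total_can _ := Mf.sel_hom_ext fun hb => by simp [iObj]

theorem iMap_id (α : Λ) (X : Mf) : iMap (le_refl α) (𝟙 X) = 𝟙 (iObj α X) :=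
  MFib.hom_ext fun γ => Mf.sel_hom_ext fun hb => by
    exact (Mf.intoSel_outSel _ hb).trans
      ((Category.comp_id _).trans (Category.id_comp (Mf.outSel hb)).symm)

theorem iMap_comp {α β γ : Λ} (h : α ≤ β) (h' : β ≤ γ) {X Y Z : Mf} (f : X ⟶ Y) (g : Y ⟶ Z) :
    iMap h f ≫ iMap h' g = iMap (h.trans h') (f ≫ g) :=
  MFib.hom_ext fun δ => Mf.sel_hom_ext fun hb => by
    refine (Mf.comp_intoSel_outSel _ _ hb).trans ((Mf.intoSel_outSel_assoc _ _ g).trans ?_)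
    exact (Category.assoc _ f g).trans
      (Mf.intoSel_outSel (fun hγ => Mf.outSel (leB_mono (h.trans h') hγ) ≫ f ≫ g) hb).symm

/-- The functors `i_α` from manifolds to multifibered manifolds, together with the natural
transformations `id^α_β : i_α ⟶ i_β`, `α ≤ β`, given by the identity maps. -/
def iFunctor : Λ ⥤ Mf ⥤ MFib Λ where
  obj α :=
    { obj := iObj α
      map := fun f => iMap le_rfl f
      map_id := fun X => iMap_id α X
      map_comp := fun f g => (iMap_comp le_rfl le_rfl f g).symm }
  map {α β} h :=
    { app := fun X => iMap (leOfHom h) (𝟙 X)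
      naturality := fun X Y f => by
        change iMap (le_refl α) f ≫ iMap (leOfHom h) (𝟙 Y) =
          iMap (leOfHom h) (𝟙 X) ≫ iMap (le_refl β) f
        rw [iMap_comp, iMap_comp, Category.id_comp, Category.comp_id] }
  map_id α := by
    ext X
    exact iMap_id α X
  map_comp f g := by
    ext X
    change iMap (leOfHom (f ≫ g)) (𝟙 X) = iMap (leOfHom f) (𝟙 X) ≫ iMap (leOfHom g) (𝟙 X)
    rw [iMap_comp, Category.comp_id]

/-- The multifibered map `j_α : π ⟶ i_α(M_α)`, given by the projections `M_γ → M_α`. -/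
def jMap (π : MFib Λ) (α : Λ) : π ⟶ iObj α (π.comp α) where
  comp γ := Mf.intoSel (leB α γ) fun hγ => π.proj (leB_iff.1 hγ)
  comm h := Mf.sel_hom_ext fun hb => by simp [iObj, π.proj_comp]
  total := π.can α
  total_can γ := Mf.sel_hom_ext fun hb => by simp [iObj, π.can_proj]

/-! ### Inductive systems of functors and the functor `T^μ`

An inductive system over `Λ` of functors from manifolds to fibered manifolds is a functor
`μ : Λ ⥤ Mf ⥤ FM`; its value at `α` is `G_α` and its value at `α ≤ β` is `μ^α_β`. -/

/-- The set `∏_μ G_α (π)` of all families `(x_α)`, `x_α ∈ G_α(M_α)`, such that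
`G_β(π^β_α)(x_β) = μ^α_β(M_α)(x_α)` for `α ≤ β`. -/
def ProdMu (μ : Λ ⥤ Mf ⥤ FM) (π : MFib Λ) : Type :=
  {x : ∀ α, ((μ.obj α).obj (π.comp α)).total //
    ∀ {α β : Λ} (h : α ≤ β), ((μ.obj β).map (π.proj h)).total.toFun (x β) =
      ((μ.map (homOfLE h)).app (π.comp α)).total.toFun (x α)}

/-- `G_α(pt)` is a point for every `α`. -/
def PointPreserving (μ : Λ ⥤ Mf ⥤ FM) : Prop :=
  ∀ α, Subsingleton ((μ.obj α).obj Mf.pt).total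

/-- The map `𝒪_α(X) : ∏_μ G (i_α(X)) → G_α(X)`, the projection to the component `α`. -/
def oMap (μ : Λ ⥤ Mf ⥤ FM) (α : Λ) (X : Mf) (x : ProdMu μ (iObj α X)) :
    ((μ.obj α).obj X).total :=
  ((μ.obj α).map (Mf.outSel (leB_iff.2 le_rfl))).total.toFun (x.1 α)

theorem map_total_comp (G : Mf ⥤ FM) {X Y Z : Mf} (f : X ⟶ Y) (g : Y ⟶ Z)
    (x : (G.obj X).total) : (G.map g).total.toFun ((G.map f).total.toFun x) =
      (G.map (f ≫ g)).total.toFun x := by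
  rw [G.map_comp]; rfl

theorem nat_total {G H : Mf ⥤ FM} (t : G ⟶ H) {X Y : Mf} (f : X ⟶ Y) (x : (G.obj X).total) :
    (H.map f).total.toFun ((t.app X).total.toFun x) =
      (t.app Y).total.toFun ((G.map f).total.toFun x) :=
  (congrArg (fun k => Mf.Hom.toFun (FM.Hom.total k) x) (t.naturality f)).symm

theorem mu_comp (μ : Λ ⥤ Mf ⥤ FM) {α β γ : Λ} (h : α ≤ β) (h' : β ≤ γ) (X : Mf)
    (x : ((μ.obj α).obj X).total) :
    ((μ.map (homOfLE h')).app X).total.toFun (((μ.map (homOfLE h)).app X).total.toFun x) =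
      ((μ.map (homOfLE (h.trans h'))).app X).total.toFun x := by
  have : μ.map (homOfLE (h.trans h')) = μ.map (homOfLE h) ≫ μ.map (homOfLE h') := by
    rw [← μ.map_comp]; rfl
  rw [this]; rfl

theorem eq_of_outSel (G : Mf ⥤ FM) (hG : Subsingleton (G.obj Mf.pt).total) {X : Mf} {b : Bool}
    {y z : (G.obj (Mf.sel X b)).total}
    (h : ∀ hb : b = true, (G.map (Mf.outSel hb)).total.toFun y =
      (G.map (Mf.outSel hb)).total.toFun z) : y = z := by
  cases b with
  | true =>
    have := h rfl
    change (G.map (𝟙 X)).total.toFun y = (G.map (𝟙 X)).total.toFun z at this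
    rw [G.map_id] at this
    exact this
  | false => exact hG.elim y z

theorem exists_outSel (G : Mf ⥤ FM) {X : Mf} (b : Bool) (f : b = true → (G.obj X).total) :
    ∃ y : (G.obj (Mf.sel X b)).total,
      ∀ hb : b = true, (G.map (Mf.outSel hb)).total.toFun y = f hb := by
  cases b with
  | true =>
    refine ⟨f rfl, fun _ => ?_⟩
    change (G.map (𝟙 X)).total.toFun (f rfl) = f rfl
    rw [G.map_id]
    rfl
  | false => exact ⟨Classical.arbitrary _, fun h => absurd h (by decide)⟩

theorem outSel_proj (μ : Λ ⥤ Mf ⥤ FM) (α : Λ) (X : Mf) {γ δ : Λ} (h : γ ≤ δ)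
    (hγ : leB α γ = true) (y : ((μ.obj δ).obj ((iObj α X).comp δ)).total) :
    ((μ.obj δ).map (Mf.outSel hγ)).total.toFun
        (((μ.obj δ).map ((iObj α X).proj h)).total.toFun y) =
      ((μ.obj δ).map (Mf.outSel (leB_trans hγ h))).total.toFun y := by
  have e : (iObj α X).proj h ≫ Mf.outSel hγ = Mf.outSel (leB_trans hγ h) :=
    Mf.intoSel_outSel _ hγ
  rw [← e]
  exact map_total_comp (μ.obj δ) ((iObj α X).proj h) (Mf.outSel hγ) y

theorem oMap_bijective (μ : Λ ⥤ Mf ⥤ FM) (hμ : PointPreserving μ) (α : Λ) (X : Mf) :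
    Function.Bijective (oMap μ α X) := by
  have hα : leB α α = true := leB_iff.2 le_rfl
  have key : ∀ (x : ProdMu μ (iObj α X)) (γ : Λ) (hγ : leB α γ = true),
      ((μ.obj γ).map (Mf.outSel hγ)).total.toFun (x.1 γ) =
        ((μ.map (homOfLE (leB_iff.1 hγ))).app X).total.toFun (oMap μ α X x) := by
    intro x γ hγ
    have h1 := congrArg ((μ.obj γ).map (Mf.outSel hα)).total.toFun (x.2 (leB_iff.1 hγ))
    rw [outSel_proj] at h1
    exact h1.trans (nat_total (μ.map (homOfLE (leB_iff.1 hγ))) (Mf.outSel hα) (x.1 α))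
  refine ⟨fun x y hxy => Subtype.ext (funext fun γ => ?_), fun z => ?_⟩
  · exact eq_of_outSel (μ.obj γ) (hμ γ) fun hγ => by rw [key x γ hγ, key y γ hγ, hxy]
  · choose x hx using fun γ => exists_outSel (μ.obj γ) (leB α γ)
      fun hγ => ((μ.map (homOfLE (leB_iff.1 hγ))).app X).total.toFun z
    refine ⟨⟨x, fun {γ δ} h => eq_of_outSel (X := X) (μ.obj δ) (hμ δ) fun hγ => ?_⟩, ?_⟩
    · refine (outSel_proj μ α X h hγ (x δ)).trans ?_
      rw [hx δ (leB_trans hγ h)]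
      refine Eq.trans ?_
        (nat_total (μ.map (homOfLE h)) (Mf.outSel hγ : Mf.sel X (leB α γ) ⟶ X) (x γ)).symm
      rw [hx γ hγ, mu_comp]
    · refine (hx α hα).trans ?_
      have : μ.map (homOfLE (le_refl α)) = 𝟙 (μ.obj α) := μ.map_id α
      rw [this]
      rfl

open Classical in
/-- A representation of `π` in the form `i_α(X)`, if there is one. -/
def rep (π : MFib Λ) : Option {a : Λ × Mf // iObj a.1 a.2 = π} :=
  if h : ∃ a : Λ × Mf, iObj a.1 a.2 = π then some ⟨h.choose, h.choose_spec⟩ else none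

/-- `G_α(X)` for a given representation `π = i_α(X)`, and `∏_μ G (π)` if there is none. -/
def TAux (μ : Λ ⥤ Mf ⥤ FM) (π : MFib Λ) : Option {a : Λ × Mf // iObj a.1 a.2 = π} → Type
  | some a => ((μ.obj a.1.1).obj a.1.2).total
  | none => ProdMu μ π

/-- `T^μ(π)`: `G_α(X)` if `π = i_α(X)`, and `∏_μ G (π)` otherwise. -/
def T (μ : Λ ⥤ Mf ⥤ FM) (π : MFib Λ) : Type := TAux μ π (rep π)

/-- `𝒪_α(X)⁻¹` or the identity. -/
def IAux (μ : Λ ⥤ Mf ⥤ FM) (hμ : PointPreserving μ) (π : MFib Λ) :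
    (r : Option {a : Λ × Mf // iObj a.1 a.2 = π}) → TAux μ π r ≃ ProdMu μ π
  | some a => (Equiv.ofBijective _ (oMap_bijective μ hμ a.1.1 a.1.2)).symm.trans
      (Equiv.cast (congrArg (ProdMu μ) a.2))
  | none => Equiv.refl _

/-- The bijection `I_π : T^μ(π) → ∏_μ G (π)`: the inverse of `𝒪_α(X)` if `π = i_α(X)`, and the
identity otherwise. -/
def I (μ : Λ ⥤ Mf ⥤ FM) (hμ : PointPreserving μ) (π : MFib Λ) : T μ π ≃ ProdMu μ π :=
  IAux μ hμ π (rep π)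

/-- A family of natural transformations `ν_α : G_α → G'_α` is compatible with `μ` and `μ'` if
`μ'^α_β(X) ∘ ν_α(X) = ν_β(X) ∘ μ^α_β(X)` for all `α ≤ β` and every manifold `X`. -/
def Compatible {μ μ' : Λ ⥤ Mf ⥤ FM} (ν : ∀ α, μ.obj α ⟶ μ'.obj α) : Prop :=
  ∀ {α β : Λ} (h : α ≤ β) (X : Mf),
    (ν α).app X ≫ (μ'.map (homOfLE h)).app X = (μ.map (homOfLE h)).app X ≫ (ν β).app X

/-- The restriction of `∏_α ν_α(M_α)` to a map `∏_μ G (π) → ∏_μ' G' (π)`. -/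
def nuProd {μ μ' : Λ ⥤ Mf ⥤ FM} (ν : ∀ α, μ.obj α ⟶ μ'.obj α) (hν : Compatible ν)
    (π : MFib Λ) (x : ProdMu μ π) : ProdMu μ' π :=
  ⟨fun α => ((ν α).app (π.comp α)).total.toFun (x.1 α), fun {α β} h => by
    rw [nat_total (ν β) (π.proj h), x.2 h]
    exact (congrArg (fun k => Mf.Hom.toFun (FM.Hom.total k) (x.1 α)) (hν h (π.comp α))).symm⟩

/-- The map `ν̃_π = I'_π⁻¹ ∘ ∏ ν_α (π) ∘ I_π : T^μ(π) → T^μ'(π)`. -/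
def nuTilde {μ μ' : Λ ⥤ Mf ⥤ FM} (hμ : PointPreserving μ) (hμ' : PointPreserving μ')
    (ν : ∀ α, μ.obj α ⟶ μ'.obj α) (hν : Compatible ν) (π : MFib Λ) (t : T μ π) : T μ' π :=
  (I μ' hμ' π).symm (nuProd ν hν π (I μ hμ π t))

/-! ### The inductive system of a bundle functor and the transformation `κ` -/

namespace BundleFunctor

/-- The inductive system `μ^F` with `G^F_α = F ∘ i_α` and `(μ^F)^α_β = F(id^α_β)`. -/
def mu (F : BundleFunctor Λ) : Λ ⥤ Mf ⥤ FM :=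
  iFunctor ⋙ (Functor.whiskeringRight Mf (MFib Λ) FM).obj F.functor

/-- `F(i_α(pt))` is a point if `F` preserves products. -/
theorem pointPreserving_mu (F : BundleFunctor Λ) (hF : F.ProductPreserving) :
    PointPreserving F.mu := by
  intro α
  have : Limits.PreservesLimitsOfShape (Discrete Limits.WalkingPair) F.functor := hF
  let P := iObj α Mf.pt
  have hP : ∀ {ρ : MFib Λ} (f g : ρ ⟶ P), f = g := fun {ρ} f g =>
    MFib.hom_ext fun γ => Mf.sel_hom_ext fun hb =>
      Mf.hom_ext fun x => Subsingleton.elim (α := Mf.pt.carrier) _ _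
  have hl : Limits.IsLimit (Limits.BinaryFan.mk (𝟙 P) (𝟙 P)) :=
    Limits.BinaryFan.isLimitMk (fun s => s.fst) (fun s => hP _ _) (fun s => hP _ _)
      (fun s m _ _ => hP _ _)
  have hl' := Limits.mapIsLimitOfPreservesOfIsLimit F.functor (𝟙 P) (𝟙 P) hl
  let Z : FM := ⟨Mf.pt, Mf.pt, 𝟙 _, Mf.isSurjSubmersion_id _⟩
  have huniq : ∀ a b : Z ⟶ F.functor.obj P, a = b := by
    intro a b
    obtain ⟨l, h1, h2⟩ := Limits.BinaryFan.IsLimit.lift' hl' a b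
    have e : F.functor.map (𝟙 P) = 𝟙 _ := F.functor.map_id P
    simp only [Limits.BinaryFan.mk_fst, Limits.BinaryFan.mk_snd] at h1 h2
    exact h1.symm.trans h2
  refine ⟨fun x y => ?_⟩
  let c : (F.functor.obj P).total → (Z ⟶ F.functor.obj P) := fun z =>
    ⟨Mf.const _ z, Mf.const _ ((F.functor.obj P).proj.toFun z), rfl⟩
  have h := huniq (c x) (c y)
  exact congrArg (fun k => Mf.Hom.toFun (FM.Hom.total k) (0 : EuclideanSpace ℝ (Fin 0))) h

/-- The map `Θ_π = ∏_α F(j_α) : F(π) → ∏_{μ^F} G^F (π)`. -/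
def Theta (F : BundleFunctor Λ) (π : MFib Λ) (y : (F.functor.obj π).total) : ProdMu F.mu π :=
  ⟨fun α => (F.functor.map (jMap π α)).total.toFun y, fun {α β} h => by
    have e : jMap π β ≫ iMap le_rfl (π.proj h) = jMap π α ≫ iMap h (𝟙 _) :=
      MFib.hom_ext fun γ => Mf.sel_hom_ext fun hb => by
        refine (Mf.comp_intoSel_outSel _ _ hb).trans (Eq.trans ?_
          (Mf.comp_intoSel_outSel _ _ hb).symm)
        refine (Mf.intoSel_outSel_assoc _ _ (π.proj h)).trans (Eq.trans ?_
          (Mf.intoSel_outSel_assoc _ _ (𝟙 (π.comp α))).symm)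
        exact (π.proj_comp h _).trans (Category.comp_id _).symm
    have e' := congrArg (fun k => Mf.Hom.toFun (FM.Hom.total (F.functor.map k)) y) e
    simp only [Functor.map_comp] at e'
    exact e'⟩

/-- The map `κ_π = I_π⁻¹ ∘ Θ_π : F(π) → T^{μ^F}(π)`. -/
def kappa (F : BundleFunctor Λ) (hF : F.ProductPreserving) (π : MFib Λ)
    (y : (F.functor.obj π).total) : T F.mu π :=
  (I F.mu (F.pointPreserving_mu hF) π).symm (F.Theta π y)

/-- The natural transformation `ν^η_α : G^F_α ⟶ G^{F'}_α`, `ν^η_α(X) = η_{i_α(X)}`. -/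
def nuOf {F F' : BundleFunctor Λ} (η : F.functor ⟶ F'.functor) (α : Λ) :
    F.mu.obj α ⟶ F'.mu.obj α :=
  Functor.whiskerLeft (iFunctor.obj α) η

theorem nuOf_app {F F' : BundleFunctor Λ} (η : F.functor ⟶ F'.functor) (α : Λ) (X : Mf) :
    (nuOf η α).app X = η.app (iObj α X) := rfl

/-- `κ_π` is a diffeomorphism, where `T^{μ^F}(π)` is regarded, through `I_π`, as a submanifold of
the product of the manifolds `G^F_α(M_α)`: the map is bijective, and its composition with `I_π`,
that is, the map `y ↦ (F(j_α)(y))_α`, is a topological embedding with injective differentials. -/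
structure KappaIsDiffeo (F : BundleFunctor Λ) (hF : F.ProductPreserving) (π : MFib Λ) : Prop where
  bijective : Function.Bijective (F.kappa hF π)
  embedding : Topology.IsEmbedding fun y : (F.functor.obj π).total =>
    (I F.mu (F.pointPreserving_mu hF) π (F.kappa hF π y)).1
  immersion : ∀ (y : (F.functor.obj π).total)
    (v : TangentSpace (𝓡 (F.functor.obj π).total.dim) y),
    (∀ α, mfderiv (𝓡 (F.functor.obj π).total.dim)
      (𝓡 ((F.mu.obj α).obj (π.comp α)).total.dim)
      (fun z => (I F.mu (F.pointPreserving_mu hF) π (F.kappa hF π z)).1 α) y v = 0) → v = 0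

end BundleFunctor

end Multifibered

end

open Multifibered

open CategoryTheory
open scoped Manifold ContDiff

noncomputable section

namespace Multifibered

open Topology

/-! ### Products described elementwise -/

/-! Everything rests on one fact about a product preserving functor $F$: the family
$\theta=(F(j_\alpha))_\alpha$ is injective on $F(\pi)$, its image is the set of all compatible
families, and it is an embedding. Once this is known for $\bar F$, the map $\eta_\pi$ is
characterized by $\bar\theta_\alpha(\eta_\pi(y))=\nu_\alpha(\theta_\alpha(y))$ (`theta_etaFun`).
Naturality, smoothness and the base map of $\eta$ are then checked after applying $\bar\theta$, and
uniqueness holds because naturality along $j_\alpha$ forces this formula.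

The fact is first proved for the local model of the spaces $\mathbb R^{\{i : p(i)\le\alpha\}}$. A
multifibered map $\rho\to i_\alpha(X)$ is the same as a smooth map $\rho_\alpha\to X$, so the local
model is the product in $\mathcal{FM}_\Lambda$ of the objects $i_{p(i)}(\mathbb R)$
(`isProd_modelProj`). Hence $F$ of it is the product of the manifolds $F(i_{p(i)}(\mathbb R))$
(`ProductPreserving.isProd_model`). Each projection of this product factors through $\theta_{p(i)}$,
which gives injectivity. A compatible family is recovered from the $i$-th coordinates of its
components at $p(i)$ (`ProductPreserving.exists_theta_eq_model`).

The general case follows by locality, since every $\pi$ is covered by open copies of its local model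
(`MFib.exists_openEmb_model`), and a point of $F(\pi)$ or a compatible family lies over a single
base point.

The differential part is carried by `LocallyRetracts`: near a given point, $y$ is a smooth function
of finitely many smooth functions of the $\theta_i(y)$. This gives at once the embedding property,
injective differentials, and the smoothness of any map whose composites with the $\theta_i$ are
smooth. It holds for products of manifolds, where the universal property supplies the retraction,
and it passes along open embeddings. -/

/-- The maps `θ i` exhibit `P` as the product of the objects `X i`. -/
def IsProd {C : Type*} [Category C] {ι : Type*} {P : C} {X : ι → C} (θ : ∀ i, P ⟶ X i) : Prop :=
  ∀ (Z : C) (f : ∀ i, Z ⟶ X i), ∃! l : Z ⟶ P, ∀ i, l ≫ θ i = f i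

namespace IsProd

variable {C : Type*} [Category C] {ι : Type*} {P : C} {X : ι → C} {θ : ∀ i, P ⟶ X i}

/-- The map into a product with given components. -/
def lift (h : IsProd θ) {Z : C} (f : ∀ i, Z ⟶ X i) : Z ⟶ P := (h Z f).choose

theorem lift_comp (h : IsProd θ) {Z : C} (f : ∀ i, Z ⟶ X i) (i : ι) : h.lift f ≫ θ i = f i :=
  (h Z f).choose_spec.1 i

theorem hom_ext (h : IsProd θ) {Z : C} {k l : Z ⟶ P} (e : ∀ i, k ≫ θ i = l ≫ θ i) : k = l :=
  (h Z fun i => l ≫ θ i).unique e fun _ => rfl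

end IsProd

namespace Mf

/-! ### Coordinate spaces -/

/-- The coordinate space `ℝ^K`. -/
def pi (K : Type) [Fintype K] : Mf where
  carrier := EuclideanSpace ℝ (Fin (Fintype.card K))
  dim := Fintype.card K

variable {K : Type} [Fintype K]

/-- The coordinates on `ℝ^K`, as a linear equivalence. -/
def piEquiv (K : Type) [Fintype K] : EuclideanSpace ℝ (Fin (Fintype.card K)) ≃L[ℝ] (K → ℝ) :=
  (EuclideanSpace.equiv _ ℝ).trans
    (LinearEquiv.funCongrLeft ℝ ℝ (Fintype.equivFin K)).toContinuousLinearEquiv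

/-- The point with given coordinates. -/
def toPi (v : K → ℝ) : pi K := (piEquiv K).symm v

/-- The coordinates of a point. -/
def ofPi (x : pi K) : K → ℝ := piEquiv K x

@[simp]
theorem ofPi_toPi (v : K → ℝ) : ofPi (toPi v) = v := (piEquiv K).apply_symm_apply v

theorem ofPi_injective : Function.Injective (ofPi (K := K)) := (piEquiv K).injective

theorem contMDiff_toPi : ContMDiff 𝓘(ℝ, K → ℝ) (𝓡 (pi K).dim) ∞ (toPi (K := K)) :=
  (piEquiv K).symm.contDiff.contMDiff

theorem contMDiff_ofPi : ContMDiff (𝓡 (pi K).dim) 𝓘(ℝ, K → ℝ) ∞ (ofPi (K := K)) :=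
  (piEquiv K).contDiff.contMDiff

theorem contMDiff_ofPi_apply (k : K) :
    ContMDiff (𝓡 (pi K).dim) 𝓘(ℝ, ℝ) ∞ fun x : pi K => ofPi x k :=
  contMDiff_pi_space.1 contMDiff_ofPi k

theorem contMDiffAt_toPi_comp {X : Mf} {f : X → K → ℝ} {x : X}
    (hf : ∀ k, ContMDiffAt (𝓡 X.dim) 𝓘(ℝ, ℝ) ∞ (fun z => f z k) x) :
    ContMDiffAt (𝓡 X.dim) (𝓡 (pi K).dim) ∞ (fun z => toPi (f z)) x :=
  (contMDiff_toPi (f x)).comp x (contMDiffAt_pi_space.2 hf)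

/-- The real line. -/
abbrev Line : Mf := pi Unit

/-- The coordinate functions on `ℝ^K`. -/
def coord (k : K) : pi K ⟶ Line :=
  ⟨fun x => toPi fun _ => ofPi x k,
    fun x => contMDiffAt_toPi_comp (K := Unit) fun _ => contMDiff_ofPi_apply k x⟩

/-- The map to `ℝ^K` with given coordinates. -/
def piLift {X : Mf} (f : K → (X ⟶ Line)) : X ⟶ pi K :=
  ⟨fun x => toPi fun k => ofPi ((f k).toFun x) (),
    fun x => contMDiffAt_toPi_comp fun k =>
      (contMDiff_ofPi_apply () ((f k).toFun x)).comp x ((f k).smooth x)⟩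

@[simp]
theorem ofPi_coord (k : K) (x : pi K) (u : Unit) : ofPi ((coord k).toFun x) u = ofPi x k := by
  simp [coord]

@[simp]
theorem ofPi_piLift {X : Mf} (f : K → (X ⟶ Line)) (x : X) (k : K) :
    ofPi ((piLift f).toFun x) k = ofPi ((f k).toFun x) () := by
  simp [piLift]

theorem isProd_coord (K : Type) [Fintype K] : IsProd (coord : K → (pi K ⟶ Line)) := by
  intro Z f
  refine ⟨piLift f, fun k => hom_ext fun x => ofPi_injective (funext fun u => by simp),
    fun l hl => hom_ext fun x => ofPi_injective (funext fun k => ?_)⟩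
  rw [ofPi_piLift, ← hl k]
  simp

theorem piLift_coord {X : Mf} (f : K → (X ⟶ Line)) (k : K) : piLift f ≫ coord k = f k :=
  hom_ext fun x => ofPi_injective (funext fun u => by simp)

/-! ### Calculus on manifolds -/

theorem Hom.continuous {X Y : Mf} (f : X ⟶ Y) : Continuous f.toFun := f.smooth.continuous

theorem Hom.mdifferentiableAt {X Y : Mf} (f : X ⟶ Y) (x : X) :
    MDifferentiableAt (𝓡 X.dim) (𝓡 Y.dim) f.toFun x :=
  (f.smooth x).mdifferentiableAt (by simp)

/-- A map with a smooth section through every point is a surjective submersion. -/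
theorem isSurjSubmersion_of_sections {X Y : Mf} (f : X ⟶ Y) (hf : Function.Surjective f.toFun)
    (h : ∀ x, ∃ σ : Y ⟶ X, σ ≫ f = 𝟙 Y ∧ σ.toFun (f.toFun x) = x) : IsSurjSubmersion f := by
  refine ⟨hf, fun x v => ?_⟩
  obtain ⟨σ, h1, h2⟩ := h x
  have h3 : f.toFun ∘ σ.toFun = id := funext fun y => congrArg (fun k => Hom.toFun k y) h1
  have h4 := mfderiv_comp (f.toFun x) (I := 𝓡 Y.dim) (I' := 𝓡 X.dim) (I'' := 𝓡 Y.dim)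
    (f.mdifferentiableAt (σ.toFun (f.toFun x))) (σ.mdifferentiableAt (f.toFun x))
  rw [h3, mfderiv_id, h2] at h4
  exact ⟨mfderiv (𝓡 Y.dim) (𝓡 X.dim) σ.toFun (f.toFun x) v, (DFunLike.congr_fun h4 v).symm⟩

namespace IsOpenEmb

variable {X Y : Mf} {f : X ⟶ Y}

theorem isOpen_range (h : IsOpenEmb f) : IsOpen (Set.range f.toFun) := h.localDiffeo.isOpen_range

/-- The inverse of a diffeomorphism onto an open subset. -/
def inv (_ : IsOpenEmb f) : Y → X := Function.invFun f.toFun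

theorem inv_apply (h : IsOpenEmb f) (x : X) : h.inv (f.toFun x) = x :=
  Function.leftInverse_invFun h.injective x

theorem apply_inv (h : IsOpenEmb f) {y : Y} (hy : y ∈ Set.range f.toFun) :
    f.toFun (h.inv y) = y := Function.invFun_eq hy

/-- Injectivity makes the globally chosen inverse agree, near `f x`, with the smooth local inverse.
-/
theorem contMDiffAt_inv (h : IsOpenEmb f) (x : X) :
    ContMDiffAt (𝓡 Y.dim) (𝓡 X.dim) ∞ h.inv (f.toFun x) := by
  have hx := h.localDiffeo x
  refine hx.localInverse_contMDiffAt.congr_of_eventuallyEq ?_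
  filter_upwards [hx.localInverse_eventuallyEq_right] with y hy
  have : f.toFun (hx.localInverse y) = y := hy
  exact (congrArg h.inv this.symm).trans (h.inv_apply _)

end IsOpenEmb

/-! ### Families of maps with a local smooth left inverse -/

/-- Near `y`, the point `z` can be recovered, by a smooth map, from finitely many smooth functions
of the points `θ i z`. -/
def LocallyRetracts {ι : Type} {P : Mf} {X : ι → Mf} (θ : ∀ i, P ⟶ X i) (y : P) : Prop :=
  ∃ (K : Type) (_ : Fintype K) (a : K → ι) (c : ∀ k, X (a k) → ℝ) (s : pi K ⟶ P),
    (∀ k, ContMDiffAt (𝓡 (X (a k)).dim) 𝓘(ℝ, ℝ) ∞ (c k) ((θ (a k)).toFun y)) ∧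
    ∀ᶠ x : ∀ i, X i in 𝓝 fun i => (θ i).toFun y, ∀ z, (fun i => (θ i).toFun z) = x →
      s.toFun (toPi fun k => c k (x (a k))) = z

section LocallyRetracts

variable {ι : Type} {P : Mf} {X : ι → Mf} {θ : ∀ i, P ⟶ X i}

/-- The retraction is continuous at the image point, so the preimage of a neighbourhood of `y` under
it, cut down to where the retraction formula holds, is a neighbourhood in the product whose pullback
lies in the given one. -/
theorem isEmbedding_of_locallyRetracts (h : ∀ y, LocallyRetracts θ y)
    (hinj : Function.Injective fun (y : P) i => (θ i).toFun y) :
    IsEmbedding fun (y : P) i => (θ i).toFun y := by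
  have hc : Continuous fun (y : P) i => (θ i).toFun y :=
    continuous_pi fun i => (θ i).continuous
  refine ⟨isInducing_iff_nhds.2 fun y => le_antisymm hc.continuousAt.le_comap ?_, hinj⟩
  obtain ⟨K, _, a, c, s, hs, hev⟩ := h y
  have h1 : ContinuousAt (fun x : ∀ i, X i => s.toFun (toPi fun k => c k (x (a k))))
      (fun i => (θ i).toFun y) := by
    refine s.continuous.continuousAt.comp (contMDiff_toPi.continuous.continuousAt.comp
      (continuousAt_pi.2 fun k => ?_))
    exact ContinuousAt.comp (f := fun x : ∀ i, X i => x (a k)) (hs k).continuousAt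
      (continuous_apply (a k)).continuousAt
  have h2 : s.toFun (toPi fun k => c k ((θ (a k)).toFun y)) = y := hev.self_of_nhds y rfl
  intro U hU
  have h3 := h1.preimage_mem_nhds (h2.symm ▸ hU)
  refine ⟨_, Filter.inter_mem h3 hev, fun z hz => ?_⟩
  have h4 := hz.2 z rfl
  rw [← h4]
  exact hz.1

/-- Near `y` the identity factors as `S ∘ u`, where each coordinate of `u` factors through some `θ
i`. A vector killed by all differentials of the `θ i` is killed by that of `u`, hence by that of the
identity. -/
theorem eq_zero_of_locallyRetracts {y : P} (h : LocallyRetracts θ y)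
    (v : TangentSpace (𝓡 P.dim) y)
    (hv : ∀ i, mfderiv (𝓡 P.dim) (𝓡 (X i).dim) (θ i).toFun y v = 0) : v = 0 := by
  obtain ⟨K, _, a, c, s, hs, hev⟩ := h
  have hc : Continuous fun (y : P) i => (θ i).toFun y :=
    continuous_pi fun i => (θ i).continuous
  let u : P → K → ℝ := fun z k => c k ((θ (a k)).toFun z)
  have hk : ∀ k, ContMDiffAt (𝓡 P.dim) 𝓘(ℝ, ℝ) ∞ (fun z => u z k) y := fun k =>
    (hs k).comp y ((θ (a k)).smooth y)
  have hu : MDifferentiableAt (𝓡 P.dim) 𝓘(ℝ, K → ℝ) u y :=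
    (contMDiffAt_pi_space.2 hk).mdifferentiableAt (by simp)
  have hd : mfderiv (𝓡 P.dim) 𝓘(ℝ, K → ℝ) u y v = 0 := by
    funext k
    let p : (K → ℝ) →L[ℝ] ℝ := ContinuousLinearMap.proj k
    have h1 : mfderiv (𝓡 P.dim) 𝓘(ℝ, ℝ) (fun z => u z k) y v = 0 := by
      have := mfderiv_comp y (I := 𝓡 P.dim) (I' := 𝓡 (X (a k)).dim) (I'' := 𝓘(ℝ, ℝ))
        ((hs k).mdifferentiableAt (by simp)) ((θ (a k)).mdifferentiableAt y)
      refine (DFunLike.congr_fun this v).trans ?_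
      change mfderiv _ _ (c k) _ (mfderiv _ _ (θ (a k)).toFun y v) = 0
      rw [hv]
      exact map_zero _
    have h2 := mfderiv_comp y (I := 𝓡 P.dim) (I' := 𝓘(ℝ, K → ℝ)) (I'' := 𝓘(ℝ, ℝ))
      (g := p) p.mdifferentiableAt hu
    have h3 := (DFunLike.congr_fun h2 v).symm.trans h1
    rw [p.mfderiv_eq] at h3
    exact h3
  let S : (K → ℝ) → P := s.toFun ∘ toPi
  have hS : MDifferentiableAt 𝓘(ℝ, K → ℝ) (𝓡 P.dim) S (u y) :=
    ((s.smooth.comp contMDiff_toPi) (u y)).mdifferentiableAt (by simp)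
  have he : S ∘ u =ᶠ[𝓝 y] id := by
    filter_upwards [hc.continuousAt.eventually hev] with z hz
    exact hz z rfl
  have h1 := mfderiv_comp y hS hu
  rw [he.mfderiv_eq, mfderiv_id] at h1
  refine (DFunLike.congr_fun h1 v).trans ?_
  change mfderiv _ _ S _ (mfderiv _ _ u y v) = 0
  rw [hd]
  exact map_zero _

/-- A map into `P` is smooth if its compositions with all `θ i` are. -/
theorem contMDiff_of_locallyRetracts (h : ∀ y, LocallyRetracts θ y) {Z : Mf} {f : Z → P}
    (hf : ∀ i, ContMDiff (𝓡 Z.dim) (𝓡 (X i).dim) ∞ fun z => (θ i).toFun (f z)) :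
    ContMDiff (𝓡 Z.dim) (𝓡 P.dim) ∞ f := by
  intro z
  obtain ⟨K, _, a, c, s, hs, hev⟩ := h (f z)
  have hc : Continuous fun (z : Z) i => (θ i).toFun (f z) :=
    continuous_pi fun i => (hf i).continuous
  have h1 : ContMDiffAt (𝓡 Z.dim) (𝓡 P.dim) ∞
      (fun z => s.toFun (toPi fun k => c k ((θ (a k)).toFun (f z)))) z :=
    (s.smooth _).comp z (contMDiffAt_toPi_comp fun k =>
      ContMDiffAt.comp (f := fun z => (θ (a k)).toFun (f z)) z (hs k) (hf (a k) z))
  refine h1.congr_of_eventuallyEq ?_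
  filter_upwards [hc.continuousAt.eventually hev] with w hw
  exact (hw (f w) rfl).symm

/-- If `θ` factors through `θ'` and retracts locally, then so does `θ'`. -/
theorem LocallyRetracts.of_factor {y : P} (h : LocallyRetracts θ y) {ι' : Type} {X' : ι' → Mf}
    {θ' : ∀ i, P ⟶ X' i} (b : ι → ι') (g : ∀ i, X' (b i) ⟶ X i)
    (hg : ∀ i, θ' (b i) ≫ g i = θ i) : LocallyRetracts θ' y := by
  obtain ⟨K, _, a, c, s, hs, hev⟩ := h
  have hg' : ∀ i z, (g i).toFun ((θ' (b i)).toFun z) = (θ i).toFun z := fun i z =>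
    congrArg (fun k => Hom.toFun k z) (hg i)
  refine ⟨K, inferInstance, fun k => b (a k), fun k x => c k ((g (a k)).toFun x), s,
    fun k => ?_, ?_⟩
  · refine ContMDiffAt.comp _ ?_ ((g (a k)).smooth _)
    rw [hg']
    exact hs k
  · have hc : Continuous fun (x : ∀ i, X' i) i => (g i).toFun (x (b i)) :=
      continuous_pi fun i => (g i).continuous.comp (continuous_apply (b i))
    have h1 : (fun i => (g i).toFun ((θ' (b i)).toFun y)) = fun i => (θ i).toFun y :=
      funext fun i => hg' i y
    have h2 := (hc.tendsto fun i => (θ' i).toFun y).eventually (h1.symm ▸ hev)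
    filter_upwards [h2] with x hx z hz
    refine hx z (funext fun i => ?_)
    rw [← hg' i z, ← hz]

/-- Transfer of local retractions along open embeddings. -/
theorem LocallyRetracts.of_openEmb [Finite ι] {y : P} (h : LocallyRetracts θ y) {P' : Mf}
    {X' : ι → Mf} {θ' : ∀ i, P' ⟶ X' i} (e : P ⟶ P') (g : ∀ i, X i ⟶ X' i)
    (hg : ∀ i, IsOpenEmb (g i)) (he : ∀ i, e ≫ θ' i = θ i ≫ g i)
    (hr : ∀ z, (∀ i, (θ' i).toFun z ∈ Set.range (g i).toFun) → z ∈ Set.range e.toFun) :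
    LocallyRetracts θ' (e.toFun y) := by
  obtain ⟨K, _, a, c, s, hs, hev⟩ := h
  have he' : ∀ i z, (θ' i).toFun (e.toFun z) = (g i).toFun ((θ i).toFun z) := fun i z =>
    congrArg (fun k => Hom.toFun k z) (he i)
  refine ⟨K, inferInstance, a, fun k x => c k ((hg (a k)).inv x), s ≫ e, fun k => ?_, ?_⟩
  · rw [he']
    refine ContMDiffAt.comp _ ?_ ((hg (a k)).contMDiffAt_inv _)
    rw [IsOpenEmb.inv_apply]
    exact hs k
  · have h1 : (fun i => (θ' i).toFun (e.toFun y)) = fun i => (g i).toFun ((θ i).toFun y) :=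
      funext fun i => he' i y
    rw [h1]
    have hc : ContinuousAt (fun (x : ∀ i, X' i) i => (hg i).inv (x i))
        (fun i => (g i).toFun ((θ i).toFun y)) :=
      continuousAt_pi.2 fun i => ContinuousAt.comp (f := fun x : ∀ i, X' i => x i)
        ((hg i).contMDiffAt_inv _).continuousAt (continuous_apply i).continuousAt
    have h2 : ∀ᶠ x : ∀ i, X' i in 𝓝 fun i => (g i).toFun ((θ i).toFun y),
        ∀ i, x i ∈ Set.range (g i).toFun :=
      Filter.eventually_all.2 fun i => (continuous_apply i).continuousAt.eventually
        ((hg i).isOpen_range.mem_nhds ⟨_, rfl⟩)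
    have h3 : (fun i => (hg i).inv ((g i).toFun ((θ i).toFun y))) = fun i => (θ i).toFun y :=
      funext fun i => (hg i).inv_apply _
    filter_upwards [h2, hc.eventually (h3.symm ▸ hev)] with x hx hx' z hz
    -- A point whose components all lie in the open pieces comes from `P`, where the given
    -- retraction applies.
    obtain ⟨w, rfl⟩ := hr z fun i => by rw [show (θ' i).toFun z = x i from congrFun hz i]; exact hx i
    refine congrArg e.toFun (hx' w (funext fun i => ?_))
    rw [← hz]
    simp only [he', IsOpenEmb.inv_apply]

end LocallyRetracts

/-! ### Parametrizations of open subsets by whole coordinate spaces -/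

theorem abs_univBall_lt {ε : ℝ} (hε : 0 < ε) (t : ℝ) :
    |OpenPartialHomeomorph.univBall (0 : ℝ) ε t| < ε := by
  have := (OpenPartialHomeomorph.univBall (0 : ℝ) ε).map_source (x := t) (by simp)
  rw [OpenPartialHomeomorph.univBall_target _ hε] at this
  simpa using this

/-- The parametrization of an open subset of `X` by a coordinate space, given by a smooth chart
whose target contains the cube of radius `ε`. -/
theorem IsSmoothChart.exists_cubeMap {X : Mf} {S : Type} [Fintype S]
    {φ : OpenPartialHomeomorph X (S → ℝ)} (hφ : X.IsSmoothChart (E := S → ℝ) φ) {ε : ℝ}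
    (hε : 0 < ε) (h : ∀ v : S → ℝ, (∀ s, |v s| < ε) → v ∈ φ.target) :
    ∃ u : pi S ⟶ X, IsOpenEmb u ∧ ∀ x, u.toFun x =
      φ.symm fun s => OpenPartialHomeomorph.univBall (0 : ℝ) ε (ofPi x s) := by
  set B := OpenPartialHomeomorph.univBall (0 : ℝ) ε with hB
  have hlt : ∀ t, |B t| < ε := abs_univBall_lt hε
  have hsrc : ∀ t, t ∈ B.source := fun t => by simp [hB]
  have hball : ∀ {t : ℝ}, |t| < ε → t ∈ Metric.ball (0 : ℝ) ε := fun ht => by simpa using ht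
  have htgt : ∀ {t : ℝ}, |t| < ε → t ∈ B.target := fun ht => by
    rw [hB, OpenPartialHomeomorph.univBall_target _ hε]; exact hball ht
  -- The line is squeezed onto `(-ε, ε)` in each coordinate separately, giving a cube rather than a
  -- ball: such a map commutes with coordinate projections.
  let g : pi S → S → ℝ := fun x s => B (ofPi x s)
  have hg : ∀ x, g x ∈ φ.target := fun x => h _ fun s => hlt _
  have hgs : ContMDiff (𝓡 (pi S).dim) 𝓘(ℝ, S → ℝ) ∞ g := contMDiff_pi_space.2 fun s =>
    (OpenPartialHomeomorph.contDiff_univBall (n := ⊤)).comp_contMDiff (contMDiff_ofPi_apply s)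
  let f : pi S → X := fun x => φ.symm (g x)
  have hf : ContMDiff (𝓡 (pi S).dim) (𝓡 X.dim) ∞ f := fun x =>
    (hφ.smooth_symm.contMDiffAt (φ.open_target.mem_nhds (hg x))).comp x (hgs x)
  let Q : Set (S → ℝ) := Set.univ.pi fun _ => Metric.ball 0 ε
  have hQ : IsOpen Q := isOpen_set_pi Set.finite_univ fun _ _ => Metric.isOpen_ball
  have hgQ : ∀ x, g x ∈ Q := fun x s _ => hball (hlt _)
  have hQt : Q ⊆ φ.target := fun v hv => h v fun s => by simpa using hv s trivial
  let f' : X → pi S := fun y => toPi fun s => B.symm (φ y s)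
  have hl : ∀ x, f' (f x) = x := fun x => by
    refine ofPi_injective (funext fun s => ?_)
    simp only [f', f, ofPi_toPi, φ.right_inv (hg x)]
    exact B.left_inv (hsrc _)
  let Φ : PartialDiffeomorph (𝓡 (pi S).dim) (𝓡 X.dim) (pi S) X ∞ :=
    { toFun := f
      invFun := f'
      source := Set.univ
      target := φ.source ∩ φ ⁻¹' Q
      map_source' := fun x _ => ⟨φ.map_target (hg x), by
        change φ (φ.symm (g x)) ∈ Q
        rw [φ.right_inv (hg x)]
        exact hgQ x⟩
      map_target' := fun _ _ => trivial
      left_inv' := fun x _ => hl x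
      right_inv' := fun y hy => by
        have : (g (f' y)) = φ y := funext fun s => by
          simp only [g, f', ofPi_toPi]
          exact B.right_inv (htgt (by simpa using hy.2 s trivial))
        change φ.symm (g (f' y)) = y
        rw [this, φ.left_inv hy.1]
      open_source := isOpen_univ
      open_target := φ.isOpen_inter_preimage hQ
      contMDiffOn_toFun := hf.contMDiffOn
      contMDiffOn_invFun := fun y hy => by
        have h1 : ContMDiffAt (𝓡 X.dim) 𝓘(ℝ, S → ℝ) ∞ φ y :=
          hφ.smooth.contMDiffAt (φ.open_source.mem_nhds hy.1)
        refine ContMDiffAt.contMDiffWithinAt (contMDiffAt_toPi_comp fun s => ?_)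
        have h2 : ContDiffAt ℝ ∞ B.symm (φ y s) :=
          OpenPartialHomeomorph.contDiffOn_univBall_symm.contDiffAt
            (Metric.isOpen_ball.mem_nhds (hy.2 s trivial))
        exact h2.comp_contMDiffAt (g := B.symm) (f := fun z => φ z s) (x := y)
          (contMDiffAt_pi_space.1 h1 s) }
  exact ⟨⟨f, hf⟩, ⟨fun x y hxy => by rw [← hl x, ← hl y]; exact congrArg f' hxy,
    fun x => ⟨Φ, trivial, fun _ _ => rfl⟩⟩, fun x => rfl⟩

theorem exists_cube_subset {S : Type} [Fintype S] {U : Set (S → ℝ)} (hU : IsOpen U)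
    (h0 : (0 : S → ℝ) ∈ U) : ∃ ε > 0, ∀ v : S → ℝ, (∀ s, |v s| < ε) → v ∈ U := by
  obtain ⟨ε, hε, h⟩ := Metric.isOpen_iff.1 hU 0 h0
  refine ⟨ε, hε, fun v hv => h ?_⟩
  rw [mem_ball_zero_iff, pi_norm_lt_iff hε]
  exact hv

/-- Every point lies in an open subset parametrized by a coordinate space. -/
theorem exists_openEmb_pi (X : Mf) (x : X) :
    ∃ u : pi (Fin X.dim) ⟶ X, IsOpenEmb u ∧ x ∈ Set.range u.toFun := by
  obtain ⟨φ, hφ, hs, he⟩ := X.exists_chart (EuclideanSpace.equiv (Fin X.dim) ℝ) x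
  have hx : x ∈ φ.source := by rw [hs]; exact mem_chart_source _ x
  have h0 : φ x = 0 := by rw [he]; simp
  obtain ⟨ε, hε, h⟩ := exists_cube_subset φ.open_target (h0 ▸ φ.map_source hx)
  obtain ⟨u, hu, hux⟩ := hφ.exists_cubeMap hε h
  refine ⟨u, hu, toPi 0, ?_⟩
  rw [hux]
  simp only [ofPi_toPi, Pi.zero_apply, OpenPartialHomeomorph.univBall_apply_zero]
  exact (congrArg φ.symm h0.symm).trans (φ.left_inv hx)

/-! ### Products in the category of manifolds -/

section IsProd

variable {ι : Type} {P : Mf} {X : ι → Mf} {θ : ∀ i, P ⟶ X i}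

/-- Points are maps from the one-point manifold, to which the universal property applies. -/
theorem bijective_of_isProd (h : IsProd θ) :
    Function.Bijective fun (y : P) i => (θ i).toFun y := by
  let o : pt := (0 : EuclideanSpace ℝ (Fin 0))
  refine ⟨fun y z hyz => ?_, fun x => ?_⟩
  · have : const pt y = const pt z := h.hom_ext fun i => hom_ext fun _ => congrFun hyz i
    exact congrArg (fun k => Hom.toFun k o) this
  · exact ⟨(h.lift fun i => const pt (x i)).toFun o, funext fun i =>
      congrArg (fun k => Hom.toFun k o) (h.lift_comp (fun i => const pt (x i)) i)⟩

/-- Parametrize a neighbourhood of each `θ i y` by a coordinate space. The universal property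
assembles these parametrizations into a smooth map `s` to `P`, and the functions `c` are the inverse
coordinates; no description of the manifold structure of `P` is needed. -/
theorem locallyRetracts_of_isProd [Fintype ι] (h : IsProd θ) (y : P) : LocallyRetracts θ y := by
  choose u hu hr using fun i => exists_openEmb_pi (X i) ((θ i).toFun y)
  let s : pi (Σ i, Fin (X i).dim) ⟶ P :=
    h.lift fun i => piLift (fun j => coord ⟨i, j⟩) ≫ u i
  refine ⟨Σ i, Fin (X i).dim, inferInstance, fun k => k.1,
    fun k x => ofPi ((hu k.1).inv x) k.2, s, fun k => ?_, ?_⟩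
  · obtain ⟨w, hw⟩ := hr k.1
    rw [← hw]
    exact ((contMDiff_ofPi_apply k.2) _).comp _ ((hu k.1).contMDiffAt_inv w)
  · have h2 : ∀ᶠ x : ∀ i, X i in 𝓝 fun i => (θ i).toFun y,
        ∀ i, x i ∈ Set.range (u i).toFun :=
      Filter.eventually_all.2 fun i => (continuous_apply i).continuousAt.eventually
        ((hu i).isOpen_range.mem_nhds (hr i))
    filter_upwards [h2] with x hx z hz
    refine (bijective_of_isProd h).1 (funext fun i => ?_)
    refine (congrArg (fun k => Hom.toFun k _) (h.lift_comp _ i)).trans ?_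
    refine Eq.trans ?_ (((hu i).apply_inv (hx i)).trans (congrFun hz i).symm)
    refine congrArg (u i).toFun (ofPi_injective (funext fun j => ?_))
    simp

end IsProd

/-- Coordinate projections are surjective submersions. -/
theorem isSurjSubmersion_reindex {S T : Type} [Fintype S] [Fintype T] {r : T → S}
    (hr : Function.Injective r) : IsSurjSubmersion (piLift fun t => coord (r t)) := by
  classical
  have h : ∀ x : pi S, ∃ σ : pi T ⟶ pi S, σ ≫ piLift (fun t => coord (r t)) = 𝟙 (pi T) ∧
      σ.toFun ((piLift fun t => coord (r t)).toFun x) = x := by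
    intro x
    -- The section through `x`: the coordinates hit by `r` are filled from the argument, the others
    -- are frozen at their values in `x`.
    let f : S → (pi T ⟶ Line) := fun s =>
      if h : ∃ t, r t = s then coord h.choose else const _ ((coord s).toFun x)
    refine ⟨piLift f, (isProd_coord T).hom_ext fun t => ?_,
      ofPi_injective (funext fun s => ?_)⟩
    · have ht : ∃ t', r t' = r t := ⟨t, rfl⟩
      rw [Category.assoc, piLift_coord, piLift_coord, Category.id_comp]
      simp only [f, dif_pos ht, hr ht.choose_spec]
    · rw [ofPi_piLift]
      by_cases hs : ∃ t, r t = s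
      · simp only [f, dif_pos hs, ofPi_coord, ofPi_piLift, hs.choose_spec]
      · simp only [f, dif_neg hs]
        exact ofPi_coord s x ()
  refine isSurjSubmersion_of_sections _ (fun y => ?_) h
  obtain ⟨σ, h1, -⟩ := h (toPi 0)
  exact ⟨σ.toFun y, congrArg (fun k => Hom.toFun k y) h1⟩

theorem exists_pi_chart {K : Type} [Fintype K] (x : pi K) :
    ∃ φ : OpenPartialHomeomorph (pi K) (K → ℝ), (pi K).IsSmoothChart (E := K → ℝ) φ ∧
      φ.source = Set.univ ∧ ∀ y k, φ y k = ofPi y k - ofPi x k := by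
  obtain ⟨φ, hφ, hs, he⟩ := (pi K).exists_chart (piEquiv K) x
  refine ⟨φ, hφ, hs.trans rfl, fun y k => ?_⟩
  rw [he]
  exact congrFun (map_sub (piEquiv K) _ _) k

end Mf

/-! ### The local models of multifibered manifolds -/

open Classical in
/-- The multifibered manifold of the coordinate spaces `ℝ^{i | p i ≤ α}`, with limit `ℝ^n`. -/
def model {Λ : Type} [PartialOrder Λ] {n : ℕ} (p : Fin n → Λ) : MFib Λ where
  comp α := Mf.pi {i : Fin n // p i ≤ α}
  proj h := Mf.piLift fun i => Mf.coord ⟨i.1, i.2.trans h⟩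
  proj_self _ := (Mf.isProd_coord _).hom_ext fun i => by
    rw [Mf.piLift_coord, Category.id_comp]
  proj_comp h h' := (Mf.isProd_coord _).hom_ext fun i => by
    rw [Category.assoc, Mf.piLift_coord, Mf.piLift_coord, Mf.piLift_coord]
  total := Mf.pi (Fin n)
  can _ := Mf.piLift fun i => Mf.coord i.1
  can_proj h := (Mf.isProd_coord _).hom_ext fun i => by
    rw [Category.assoc, Mf.piLift_coord, Mf.piLift_coord, Mf.piLift_coord]
  limit x hx := by
    refine ⟨Mf.toPi fun i => Mf.ofPi (x (p i)) ⟨i, le_rfl⟩, fun α => ?_, fun y hy => ?_⟩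
    · refine Mf.ofPi_injective (funext fun i => ?_)
      rw [Mf.ofPi_piLift, Mf.ofPi_coord, Mf.ofPi_toPi, ← hx i.2, Mf.ofPi_piLift, Mf.ofPi_coord]
    · refine Mf.ofPi_injective (funext fun i => ?_)
      rw [Mf.ofPi_toPi, ← hy, Mf.ofPi_piLift, Mf.ofPi_coord]
  proj_submersion h := Mf.isSurjSubmersion_reindex fun i j hij =>
    Subtype.ext (congrArg (fun k => k.1) hij)
  can_submersion _ := Mf.isSurjSubmersion_reindex Subtype.val_injective
  locally_model := by
    refine ⟨n, p, fun x => ?_⟩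
    obtain ⟨φ, hφ, hs, he⟩ := Mf.exists_pi_chart x
    choose ψ hψ hψs hψe using fun α => Mf.exists_pi_chart
      ((Mf.piLift fun i : {i : Fin n // p i ≤ α} => Mf.coord i.1).toFun x)
    refine ⟨φ, ψ, hφ, by rw [hs]; trivial, funext fun i => by rw [he]; exact sub_self _,
      fun α => ⟨hψ α, by rw [hψs]; trivial, funext fun i => by rw [hψe]; exact sub_self _,
        fun y _ => ⟨by rw [hψs]; trivial, fun i => ?_⟩⟩⟩
    rw [hψe, he, Mf.ofPi_piLift, Mf.ofPi_coord, Mf.ofPi_piLift, Mf.ofPi_coord]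

section Model

variable {Λ : Type} [PartialOrder Λ] {n : ℕ} (p : Fin n → Λ)

open Classical in
/-- The coordinates on the components of the local model. -/
def modelCoord (α : Λ) (i : {i : Fin n // p i ≤ α}) : (model p).comp α ⟶ Mf.Line := Mf.coord i

open Classical in
theorem isProd_modelCoord (α : Λ) : IsProd (modelCoord p α) := Mf.isProd_coord _

open Classical in
theorem model_proj_coord {α β : Λ} (h : α ≤ β) (i : {i : Fin n // p i ≤ α}) :
    (model p).proj h ≫ modelCoord p α i = modelCoord p β ⟨i.1, i.2.trans h⟩ :=
  Mf.piLift_coord _ _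

/-- The coordinates on the limit of the local model. -/
def modelTotalCoord (i : Fin n) : (model p).total ⟶ Mf.Line := Mf.coord i

theorem isProd_modelTotalCoord : IsProd (modelTotalCoord p) := Mf.isProd_coord _

open Classical in
theorem model_can_coord (α : Λ) (i : {i : Fin n // p i ≤ α}) :
    (model p).can α ≫ modelCoord p α i = modelTotalCoord p i.1 :=
  Mf.piLift_coord _ _

end Model

/-! ### Maps into `i_α(X)` as maps from the component at `α`, and the local model as a product -/

section Adjunction

variable {Λ : Type} [PartialOrder Λ]

/-- The identity map from a nontrivial component of `i_α(X)` to `X`. -/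
def iOut (α : Λ) (X : Mf) {γ : Λ} (h : α ≤ γ) : (iObj α X).comp γ ⟶ X := Mf.outSel (leB_iff.2 h)

theorem iObj_hom_ext {Y : Mf} {α : Λ} {X : Mf} {γ : Λ} {f g : Y ⟶ (iObj α X).comp γ}
    (e : ∀ h : α ≤ γ, f ≫ iOut α X h = g ≫ iOut α X h) : f = g :=
  Mf.sel_hom_ext fun hb => e (leB_iff.1 hb)

theorem iObj_proj_iOut (α : Λ) (X : Mf) {γ δ : Λ} (h : α ≤ γ) (h' : γ ≤ δ) :
    (iObj α X).proj h' ≫ iOut α X h = iOut α X (h.trans h') := Mf.intoSel_outSel _ _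

theorem iMap_comp_iOut {α β γ : Λ} (h : α ≤ β) {X Y : Mf} (f : X ⟶ Y) (h' : β ≤ γ) :
    (iMap h f).comp γ ≫ iOut β Y h' = iOut α X (h.trans h') ≫ f := Mf.intoSel_outSel _ _

theorem jMap_comp_iOut (π : MFib Λ) {α γ : Λ} (h : α ≤ γ) :
    (jMap π α).comp γ ≫ iOut α _ h = π.proj h := Mf.intoSel_outSel _ _

/-- The component at `α` of a multifibered map into `i_α(X)`. -/
def iVal {ρ : MFib Λ} {α : Λ} {X : Mf} (f : ρ ⟶ iObj α X) : ρ.comp α ⟶ X :=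
  f.comp α ≫ iOut α X le_rfl

/-- The nontrivial projections of `i_α(X)` are identities, so commutation with the projections
expresses every component above `α` through the one at `α`; all other components go to a point.
Hence `iVal` is injective, and `iHom` inverts it. -/
theorem comp_iOut {ρ : MFib Λ} {α γ : Λ} {X : Mf} (f : ρ ⟶ iObj α X) (h : α ≤ γ) :
    f.comp γ ≫ iOut α X h = ρ.proj h ≫ iVal f := by
  rw [iVal, ← Category.assoc, ← f.comm h, Category.assoc, iObj_proj_iOut]

theorem iVal_injective {ρ : MFib Λ} {α : Λ} {X : Mf} {f g : ρ ⟶ iObj α X}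
    (h : iVal f = iVal g) : f = g :=
  MFib.hom_ext fun γ => iObj_hom_ext fun hγ => by rw [comp_iOut, comp_iOut, h]

theorem iVal_comp {ρ σ : MFib Λ} {α : Λ} {X : Mf} (k : ρ ⟶ σ) (f : σ ⟶ iObj α X) :
    iVal (k ≫ f) = k.comp α ≫ iVal f := Category.assoc _ _ _

theorem iVal_iMap {α β : Λ} (h : α ≤ β) {X Y : Mf} (f : X ⟶ Y) :
    iVal (iMap h f) = iOut α X h ≫ f := iMap_comp_iOut h f le_rfl

theorem iVal_comp_iMap {ρ : MFib Λ} {α β : Λ} (h : α ≤ β) {X Y : Mf} (f : ρ ⟶ iObj α X)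
    (g : X ⟶ Y) : iVal (f ≫ iMap h g) = ρ.proj h ≫ iVal f ≫ g := by
  rw [iVal_comp, iVal_iMap, ← Category.assoc, comp_iOut, Category.assoc]

theorem iVal_jMap (π : MFib Λ) (α : Λ) : iVal (jMap π α) = 𝟙 (π.comp α) :=
  (jMap_comp_iOut π le_rfl).trans (π.proj_self α)

theorem iVal_jMap_comp_iMap {π : MFib Λ} {α β : Λ} (h : α ≤ β) {X : Mf} (g : π.comp α ⟶ X) :
    iVal (jMap π α ≫ iMap h g) = π.proj h ≫ g := by
  rw [iVal_comp_iMap, iVal_jMap, Category.id_comp]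

/-- The multifibered map `ρ ⟶ i_α(X)` given by a map `ρ_α ⟶ X`. -/
def iHom {ρ : MFib Λ} {α : Λ} {X : Mf} (h : ρ.comp α ⟶ X) : ρ ⟶ iObj α X :=
  jMap ρ α ≫ iMap le_rfl h

@[simp]
theorem iVal_iHom {ρ : MFib Λ} {α : Λ} {X : Mf} (h : ρ.comp α ⟶ X) :
    iVal (iHom h : ρ ⟶ iObj α X) = h := by
  rw [iHom, iVal_jMap_comp_iMap, ρ.proj_self, Category.id_comp]

theorem comp_jMap {π ρ : MFib Λ} (f : π ⟶ ρ) (α : Λ) :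
    f ≫ jMap ρ α = jMap π α ≫ iMap le_rfl (f.comp α) := by
  refine iVal_injective ?_
  rw [iVal_comp, iVal_jMap, iVal_jMap_comp_iMap, π.proj_self, Category.comp_id, Category.id_comp]

/-- Links `Θ` at `i_α(X)` with the inductive system: its component at `β ≥ α` is `F(id^α_β)` up to
the identification `iOut`. -/
theorem jMap_comp_iMap_iOut {α β : Λ} (X : Mf) (h : α ≤ β) :
    jMap (iObj α X) β ≫ iMap le_rfl (iOut α X h) = iMap h (𝟙 X) := by
  refine iVal_injective ?_
  rw [iVal_jMap_comp_iMap, (iObj α X).proj_self, iVal_iMap, Category.comp_id, Category.id_comp]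

/-- The coordinate projections of the local model. -/
def modelProj {n : ℕ} (p : Fin n → Λ) (i : Fin n) : model p ⟶ iObj (p i) Mf.Line :=
  iHom (modelCoord p (p i) ⟨i, le_rfl⟩)

/-- The `i`-th coordinate of a map into the model at level `α` must be its coordinate at level `p i`
pulled back along `ρ_α → ρ_{p i}`. So one map `ρ_{p i} → ℝ` for each `i` is exactly the data of a
multifibered map, and such maps are the maps into `i_{p i}(ℝ)`. -/
theorem isProd_modelProj {n : ℕ} (p : Fin n → Λ) : IsProd (modelProj p) := by
  intro ρ f
  let l : ρ ⟶ model p :=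
    { comp := fun α => (isProd_modelCoord p α).lift fun i => ρ.proj i.2 ≫ iVal (f i.1)
      comm := fun {α β} h => (isProd_modelCoord p α).hom_ext fun i => by
        rw [Category.assoc, model_proj_coord, IsProd.lift_comp, Category.assoc, IsProd.lift_comp,
          ← Category.assoc, ρ.proj_comp]
      total := (isProd_modelTotalCoord p).lift fun i => ρ.can (p i) ≫ iVal (f i)
      total_can := fun α => (isProd_modelCoord p α).hom_ext fun i => by
        rw [Category.assoc, model_can_coord, IsProd.lift_comp, Category.assoc, IsProd.lift_comp,
          ← Category.assoc, ρ.can_proj] }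
  have hval : ∀ (k : ρ ⟶ model p) i, iVal (k ≫ modelProj p i) =
      k.comp (p i) ≫ modelCoord p (p i) ⟨i, le_rfl⟩ := fun k i => by
    rw [iVal_comp, modelProj, iVal_iHom]
  refine ⟨l, fun i => iVal_injective ?_, fun k hk => MFib.hom_ext fun α =>
    (isProd_modelCoord p α).hom_ext fun i => ?_⟩
  · rw [hval]
    change (isProd_modelCoord p _).lift _ ≫ _ = _
    rw [IsProd.lift_comp, ρ.proj_self, Category.id_comp]
  · change _ = (isProd_modelCoord p _).lift _ ≫ _
    rw [IsProd.lift_comp, ← hk i.1, hval, ← Category.assoc, ← k.comm, Category.assoc,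
      model_proj_coord]

/-- `i_α` preserves products. -/
theorem IsProd.iMap {ι : Type} {X : Mf} {Y : ι → Mf} {θ : ∀ i, X ⟶ Y i} (h : IsProd θ) (α : Λ) :
    IsProd fun i => iMap (le_refl α) (θ i) := by
  intro ρ f
  have hval : ∀ (l : ρ ⟶ iObj α X) i,
      iVal (l ≫ Multifibered.iMap (le_refl α) (θ i)) = iVal l ≫ θ i := fun l k => by
    rw [iVal_comp_iMap, ρ.proj_self, Category.id_comp]
  refine ⟨iHom (h.lift fun i => iVal (f i)), fun i => iVal_injective ?_, fun l hl =>
    iVal_injective (h.hom_ext fun i => ?_)⟩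
  · rw [hval, iVal_iHom, lift_comp]
  · rw [← hval, hl, iVal_iHom, lift_comp]

end Adjunction

/-- Maps into a product of `n + 1` objects, in terms of the first factor and the product of the
others. -/
theorem IsProd.existsUnique_succ {C : Type*} [Category C] {n : ℕ} {P P' : C} {X : Fin (n + 1) → C}
    {θ : ∀ i, P ⟶ X i} (h : IsProd θ) {θ' : ∀ i : Fin n, P' ⟶ X i.succ} (h' : IsProd θ')
    {t : P ⟶ P'} (ht : ∀ i, t ≫ θ' i = θ i.succ) (Z : C) (f : Z ⟶ X 0) (g : Z ⟶ P') :
    ∃! l : Z ⟶ P, l ≫ θ 0 = f ∧ l ≫ t = g := by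
  refine ⟨h.lift (Fin.cons f fun i => g ≫ θ' i), ⟨h.lift_comp _ 0, h'.hom_ext fun i => ?_⟩,
    fun l hl => h.hom_ext fun i => ?_⟩
  · rw [Category.assoc, ht, h.lift_comp, Fin.cons_succ]
  · rw [h.lift_comp]
    refine Fin.cases hl.1 (fun i => ?_) i
    rw [Fin.cons_succ, ← hl.2, Category.assoc, ht]

/-- The converse of `IsProd.existsUnique_succ`. -/
theorem isProd_of_existsUnique {C : Type*} [Category C] {n : ℕ} {P P' : C} {X : Fin (n + 1) → C}
    {θ : ∀ i, P ⟶ X i} {θ' : ∀ i : Fin n, P' ⟶ X i.succ} (h' : IsProd θ')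
    {t : P ⟶ P'} (ht : ∀ i, t ≫ θ' i = θ i.succ)
    (h : ∀ (Z : C) (f : Z ⟶ X 0) (g : Z ⟶ P'), ∃! l : Z ⟶ P, l ≫ θ 0 = f ∧ l ≫ t = g) :
    IsProd θ := by
  intro Z f
  obtain ⟨l, hl, hu⟩ := h Z (f 0) (h'.lift fun i => f i.succ)
  refine ⟨l, Fin.cases hl.1 fun i => ?_, fun k hk => hu k ⟨hk 0, h'.hom_ext fun i => ?_⟩⟩
  · rw [Category.assoc, ht, hk, h'.lift_comp]
  · rw [← ht, ← Category.assoc, hl.2, h'.lift_comp]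

/-! ### Values of product preserving functors on local models and on products of lines -/

namespace BundleFunctor

variable {Λ : Type} [PartialOrder Λ] {F : BundleFunctor Λ}

/-- The total spaces of the values of a product preserving bundle functor at a binary product form
a product of manifolds. -/
theorem ProductPreserving.existsUnique (hF : F.ProductPreserving) {P A B : MFib Λ} (a : P ⟶ A)
    (b : P ⟶ B) (h : ∀ (Z : MFib Λ) (f : Z ⟶ A) (g : Z ⟶ B), ∃! l : Z ⟶ P, l ≫ a = f ∧ l ≫ b = g)
    (Z : Mf) (f : Z ⟶ F.tot.obj A) (g : Z ⟶ F.tot.obj B) :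
    ∃! l : Z ⟶ F.tot.obj P, l ≫ F.tot.map a = f ∧ l ≫ F.tot.map b = g := by
  have : Limits.PreservesLimitsOfShape (Discrete Limits.WalkingPair) F.functor := hF
  have hl : Limits.IsLimit (Limits.BinaryFan.mk a b) :=
    Limits.BinaryFan.isLimitMk (fun s => (h _ s.fst s.snd).choose)
      (fun s => (h _ s.fst s.snd).choose_spec.1.1) (fun s => (h _ s.fst s.snd).choose_spec.1.2)
      (fun s m h₁ h₂ => (h _ s.fst s.snd).choose_spec.2 m ⟨h₁, h₂⟩)
  have hl' := Limits.mapIsLimitOfPreservesOfIsLimit F.functor a b hl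
  -- Fibered maps from the identity fibration over `Z` are just smooth maps from `Z` to the total
  -- space, so a product of fibered manifolds yields one of total spaces.
  let Z' : FM := ⟨Z, Z, 𝟙 _, Mf.isSurjSubmersion_id _⟩
  let u : ∀ {Q : MFib Λ}, (Z ⟶ F.tot.obj Q) → (Z' ⟶ F.functor.obj Q) := fun {Q} k =>
    ⟨k, k ≫ (F.functor.obj Q).proj, (Category.id_comp _).symm⟩
  have hu : ∀ {Q R : MFib Λ} (k : Z ⟶ F.tot.obj Q) (m : Q ⟶ R),
      u k ≫ F.functor.map m = u (k ≫ F.tot.map m) := fun {Q R} k m => by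
    refine FM.hom_ext rfl ?_
    change (k ≫ F.proj.app Q) ≫ (totalFunctor Λ).map m = (k ≫ F.tot.map m) ≫ F.proj.app R
    rw [Category.assoc, ← F.proj.naturality, ← Category.assoc]
  obtain ⟨l, h1, h2⟩ := Limits.BinaryFan.IsLimit.lift' hl' (u f) (u g)
  refine ⟨l.total, ⟨congrArg FM.Hom.total h1, congrArg FM.Hom.total h2⟩, fun k hk => ?_⟩
  have e : u k = l := Limits.BinaryFan.IsLimit.hom_ext hl'
    (((hu k a).trans (congrArg u hk.1)).trans h1.symm)
    (((hu k b).trans (congrArg u hk.2)).trans h2.symm)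
  exact congrArg FM.Hom.total e

/-- Such a `P` is its own square with both projections the identity. Preservation of this product
makes any two points of `F(P)` equal. -/
theorem ProductPreserving.subsingleton (hF : F.ProductPreserving) {P : MFib Λ}
    (hP : ∀ {ρ : MFib Λ} (f g : ρ ⟶ P), f = g) : Subsingleton (F.tot.obj P) := by
  have h := hF.existsUnique (𝟙 P) (𝟙 P) fun Z f g => ⟨f, ⟨hP _ _, hP _ _⟩, fun _ _ => hP _ _⟩
  refine ⟨fun x y => ?_⟩
  obtain ⟨l, ⟨h1, h2⟩, -⟩ := h Mf.pt (Mf.const _ x) (Mf.const _ y)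
  exact congrArg (fun k => Mf.Hom.toFun k (0 : EuclideanSpace ℝ (Fin 0))) (h1.symm.trans h2)

/-- Only binary products are preserved by hypothesis, so one line is split off at a time; the empty
product is a point by `ProductPreserving.subsingleton`. -/
theorem ProductPreserving.isProd_model (hF : F.ProductPreserving) {n : ℕ} (p : Fin n → Λ) :
    IsProd fun i => F.tot.map (modelProj p i) := by
  induction n with
  | zero =>
    have : Subsingleton (F.tot.obj (model p)) := hF.subsingleton fun f g =>
      (isProd_modelProj p).hom_ext fun i => i.elim0
    exact fun Z f => ⟨Mf.const Z (Classical.arbitrary _), fun i => i.elim0,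
      fun l _ => Mf.hom_ext fun x => Subsingleton.elim _ _⟩
  | succ n ih =>
    have h' := isProd_modelProj fun i : Fin n => p i.succ
    let t : model p ⟶ model fun i : Fin n => p i.succ := h'.lift fun i => modelProj p i.succ
    have ht : ∀ i, t ≫ modelProj (fun i : Fin n => p i.succ) i = modelProj p i.succ :=
      fun i => h'.lift_comp _ i
    refine isProd_of_existsUnique (ih fun i => p i.succ) (t := F.tot.map t) (fun i => ?_) ?_
    · rw [← F.tot.map_comp, ht]
    · exact hF.existsUnique _ _ ((isProd_modelProj p).existsUnique_succ h' ht)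

/-- Points of `F(i_α(X))`, for `X` a product of lines, are determined by their coordinates. -/
theorem ProductPreserving.eq_of_coord (hF : F.ProductPreserving) (α : Λ) {X : Mf} {K : Type}
    [Finite K] {c : K → (X ⟶ Mf.Line)} (hc : IsProd c) {x y : F.tot.obj (iObj α X)}
    (h : ∀ k, (F.tot.map (iMap (le_refl α) (c k))).toFun x =
      (F.tot.map (iMap (le_refl α) (c k))).toFun y) : x = y := by
  obtain ⟨n, ⟨e⟩⟩ := Finite.exists_equiv_fin K
  let θ : Fin n → (X ⟶ Mf.Line) := fun i => c (e.symm i)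
  have hθ : IsProd θ := fun Z f =>
    ⟨hc.lift fun k => f (e k), fun i => by rw [hc.lift_comp, e.apply_symm_apply],
      fun l hl => hc.hom_ext fun k => by
        rw [hc.lift_comp, ← hl (e k)]
        simp only [θ, e.symm_apply_apply]⟩
  let p : Fin n → Λ := fun _ => α
  -- The comparison with the model for constant `p`. It has the left inverse `l'`, hence `F(l)` is
  -- injective, and points of `F` of the model are separated by their coordinates.
  let l : iObj α X ⟶ model p := (isProd_modelProj p).lift fun i => iMap (le_refl α) (θ i)
  have hl : ∀ i, l ≫ modelProj p i = iMap (le_refl α) (θ i) := (isProd_modelProj p).lift_comp _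
  let l' : model p ⟶ iObj α X := (hθ.iMap α).lift (modelProj p)
  have hl' : ∀ i, l' ≫ iMap (le_refl α) (θ i) = modelProj p i := (hθ.iMap α).lift_comp _
  have hll' : l ≫ l' = 𝟙 _ := (hθ.iMap α).hom_ext fun i => by
    rw [Category.assoc, hl', hl, Category.id_comp]
  have h1 : (F.tot.map l).toFun x = (F.tot.map l).toFun y := by
    refine (Mf.bijective_of_isProd (hF.isProd_model p)).1 (funext fun i => ?_)
    have h2 := h (e.symm i)
    change (F.tot.map (iMap (le_refl α) (θ i))).toFun x =
      (F.tot.map (iMap (le_refl α) (θ i))).toFun y at h2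
    rw [← hl i, F.tot.map_comp] at h2
    exact h2
  have h3 := congrArg (F.tot.map l').toFun h1
  rw [← Mf.comp_toFun, ← Mf.comp_toFun, ← F.tot.map_comp, hll', F.tot.map_id] at h3
  exact h3

end BundleFunctor

/-! ### Open coverings by copies of the local model -/

variable {Λ : Type} [PartialOrder Λ]

theorem MFib.can_proj_apply (π : MFib Λ) {α β : Λ} (h : α ≤ β) (y : π.total) :
    (π.proj h).toFun ((π.can β).toFun y) = (π.can α).toFun y :=
  congrArg (fun k => Mf.Hom.toFun k y) (π.can_proj h)

theorem MFib.total_ext (π : MFib Λ) {y z : π.total}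
    (h : ∀ α, (π.can α).toFun y = (π.can α).toFun z) : y = z :=
  (π.limit (fun α => (π.can α).toFun z) fun h => π.can_proj_apply h z).unique h fun _ => rfl

theorem MFib.Hom.can_total {π ρ : MFib Λ} (f : π ⟶ ρ) (α : Λ) (y : π.total) :
    (ρ.can α).toFun (f.total.toFun y) = (f.comp α).toFun ((π.can α).toFun y) :=
  congrArg (fun k => Mf.Hom.toFun k y) (f.total_can α)

theorem MFib.Hom.proj_comp {π ρ : MFib Λ} (f : π ⟶ ρ) {α β : Λ} (h : α ≤ β) (y : π.comp β) :
    (ρ.proj h).toFun ((f.comp β).toFun y) = (f.comp α).toFun ((π.proj h).toFun y) :=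
  congrArg (fun k => Mf.Hom.toFun k y) (f.comm h)

/-- The limit of the ranges of injective components is the range of the limit map. -/
theorem MFib.Hom.mem_range_total {π ρ : MFib Λ} (e : π ⟶ ρ)
    (he : ∀ α, Function.Injective (e.comp α).toFun) (y : ρ.total)
    (hy : ∀ α, (ρ.can α).toFun y ∈ Set.range (e.comp α).toFun) :
    y ∈ Set.range e.total.toFun := by
  choose x hx using hy
  obtain ⟨z, hz, -⟩ := π.limit x fun {α β} h => he α (by
    rw [← e.proj_comp, hx, hx, ρ.can_proj_apply])
  exact ⟨z, ρ.total_ext fun α => by rw [e.can_total, hz, hx]⟩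

open Classical in
theorem ofPi_model_can {n : ℕ} (p : Fin n → Λ) (α : Λ) (v : (model p).total)
    (i : {i : Fin n // p i ≤ α}) :
    Mf.ofPi (K := {i : Fin n // p i ≤ α}) (((model p).can α).toFun v) i =
      Mf.ofPi (K := Fin n) v i.1 :=
  (Mf.ofPi_piLift _ _ _).trans (Mf.ofPi_coord _ _ _)

open Classical in
/-- A multifibered manifold is covered by open multifibered submanifolds isomorphic to the local
model. -/
theorem MFib.exists_openEmb_model (π : MFib Λ) : ∃ (n : ℕ) (p : Fin n → Λ), ∀ x : π.total,
    ∃ e : model p ⟶ π, (∀ α, Mf.IsOpenEmb (e.comp α)) ∧ x ∈ Set.range e.total.toFun := by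
  obtain ⟨n, p, H⟩ := π.locally_model
  refine ⟨n, p, fun x => ?_⟩
  obtain ⟨φ, ψ, hφ, hx, h0, hψ⟩ := H x
  obtain ⟨ε, hε, hcube⟩ := Mf.exists_cube_subset φ.open_target (h0 ▸ φ.map_source hx)
  obtain ⟨u, -, hu⟩ : ∃ u : (model p).total ⟶ π.total, Mf.IsOpenEmb u ∧ ∀ v, u.toFun v =
      φ.symm fun s => OpenPartialHomeomorph.univBall (0 : ℝ) ε (Mf.ofPi (K := Fin n) v s) :=
    hφ.exists_cubeMap hε hcube
  have hcube' : ∀ α, ∀ v : {i : Fin n // p i ≤ α} → ℝ, (∀ i, |v i| < ε) → v ∈ (ψ α).target := by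
    intro α v hv
    -- Extension by zero stays in the cube; the projection of its preimage under `φ` has coordinates
    -- `v`. Thus one `ε` serves for all `α`.
    let w : Fin n → ℝ := fun i => if h : p i ≤ α then v ⟨i, h⟩ else 0
    have hw : w ∈ φ.target := hcube w fun i => by
      by_cases h : p i ≤ α
      · simpa only [w, dif_pos h] using hv ⟨i, h⟩
      · simpa only [w, dif_neg h, abs_zero] using hε
    obtain ⟨h1, h2⟩ := (hψ α).2.2.2 _ (φ.map_target hw)
    have h3 : ψ α ((π.can α).toFun (φ.symm w)) = v := funext fun i => by
      rw [h2, φ.right_inv hw]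
      simp only [w, dif_pos i.2]
    exact h3 ▸ (ψ α).map_source h1
  have hcomp : ∀ α, ∃ c : (model p).comp α ⟶ π.comp α, Mf.IsOpenEmb c ∧ ∀ v, c.toFun v =
      (ψ α).symm fun s => OpenPartialHomeomorph.univBall (0 : ℝ) ε
        (Mf.ofPi (K := {i : Fin n // p i ≤ α}) v s) := fun α => (hψ α).1.exists_cubeMap hε (hcube' α)
  choose c hc hcx using hcomp
  have hcan : ∀ α (v : (model p).total), (π.can α).toFun (u.toFun v) =
      (c α).toFun (((model p).can α).toFun v) := by
    intro α v
    rw [hu, hcx]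
    have hv := hcube (fun s => OpenPartialHomeomorph.univBall (0 : ℝ) ε (Mf.ofPi (K := Fin n) v s))
      fun s => Mf.abs_univBall_lt hε _
    obtain ⟨h1, h2⟩ := (hψ α).2.2.2 _ (φ.map_target hv)
    refine ((ψ α).left_inv h1).symm.trans (congrArg (ψ α).symm (funext fun i => ?_))
    rw [h2, φ.right_inv hv, ofPi_model_can]
  let e : model p ⟶ π :=
    { comp := c
      comm := fun {α β} h => Mf.hom_ext fun v => by
        -- Compatibility of the `c α` can be tested on the limit, which surjects onto each
        -- component.
        obtain ⟨w, rfl⟩ := ((model p).can_submersion β).surjective v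
        rw [Mf.comp_toFun, Mf.comp_toFun, (model p).can_proj_apply, ← hcan, ← hcan,
          π.can_proj_apply]
      total := u
      total_can := fun α => Mf.hom_ext fun v => hcan α v }
  refine ⟨e, hc, Mf.toPi 0, ?_⟩
  refine (hu _).trans ?_
  simp only [Mf.ofPi_toPi, Pi.zero_apply, OpenPartialHomeomorph.univBall_apply_zero]
  exact (congrArg φ.symm h0.symm).trans (φ.left_inv hx)

theorem Mf.isOpenEmb_id (X : Mf) : Mf.IsOpenEmb (𝟙 X) :=
  ⟨fun _ _ h => h, (Diffeomorph.refl (𝓡 X.dim) X ∞).isLocalDiffeomorph⟩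

theorem Mf.IsOpenEmb.intoSel {X Y : Mf} {g : X ⟶ Y} (hg : Mf.IsOpenEmb g) (b : Bool) :
    Mf.IsOpenEmb (Mf.intoSel b fun h => (Mf.outSel h : Mf.sel X b ⟶ X) ≫ g) := by
  cases b with
  | true => exact hg
  | false =>
    have : Mf.toPt Mf.pt = 𝟙 Mf.pt :=
      Mf.hom_ext fun x => Subsingleton.elim (α := Mf.pt.carrier) _ _
    change Mf.IsOpenEmb (Mf.toPt Mf.pt)
    rw [this]
    exact Mf.isOpenEmb_id Mf.pt

theorem Mf.IsOpenEmb.iMap {X Y : Mf} {g : X ⟶ Y} (hg : Mf.IsOpenEmb g) (α γ : Λ) :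
    Mf.IsOpenEmb ((Multifibered.iMap (le_refl α) g).comp γ) :=
  hg.intoSel (leB α γ)

/-! ### The maps `F(j_α)`: injectivity, local retractions and compatible families -/

namespace BundleFunctor

variable {F : BundleFunctor Λ}

/-- The maps `F(j_α) : F(π) → F(i_α(M_α))`. -/
def theta (F : BundleFunctor Λ) (π : MFib Λ) (α : Λ) :
    F.tot.obj π ⟶ F.tot.obj (iObj α (π.comp α)) := F.tot.map (jMap π α)

theorem map_map (F : BundleFunctor Λ) {π ρ σ : MFib Λ} (f : π ⟶ ρ) (g : ρ ⟶ σ)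
    (y : F.tot.obj π) :
    (F.tot.map g).toFun ((F.tot.map f).toFun y) = (F.tot.map (f ≫ g)).toFun y := by
  rw [F.tot.map_comp, Mf.comp_toFun]

theorem theta_map (F : BundleFunctor Λ) {π ρ : MFib Λ} (f : π ⟶ ρ) (α : Λ) (y : F.tot.obj π) :
    (F.theta ρ α).toFun ((F.tot.map f).toFun y) =
      (F.tot.map (iMap le_rfl (f.comp α))).toFun ((F.theta π α).toFun y) := by
  rw [theta, theta, map_map, map_map, comp_jMap]

theorem proj_map (F : BundleFunctor Λ) {π ρ : MFib Λ} (f : π ⟶ ρ) (y : F.tot.obj π) :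
    (F.proj.app ρ).toFun ((F.tot.map f).toFun y) = f.total.toFun ((F.proj.app π).toFun y) :=
  congrArg (fun k => Mf.Hom.toFun k y) (F.proj.naturality f)

theorem proj_theta (F : BundleFunctor Λ) (π : MFib Λ) (α : Λ) (y : F.tot.obj π) :
    (F.proj.app (iObj α (π.comp α))).toFun ((F.theta π α).toFun y) =
      (π.can α).toFun ((F.proj.app π).toFun y) :=
  F.proj_map (jMap π α) y

theorem isOpenEmb_map (F : BundleFunctor Λ) {π ρ : MFib Λ} {f : π ⟶ ρ}
    (hf : ∀ α, Mf.IsOpenEmb (f.comp α)) : Mf.IsOpenEmb (F.tot.map f) := (F.locality f hf).1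

theorem mem_range_map (F : BundleFunctor Λ) {π ρ : MFib Λ} {f : π ⟶ ρ}
    (hf : ∀ α, Mf.IsOpenEmb (f.comp α)) {y : F.tot.obj ρ} :
    y ∈ Set.range (F.tot.map f).toFun ↔ (F.proj.app ρ).toFun y ∈ Set.range f.total.toFun := by
  rw [(F.locality f hf).2]
  rfl

theorem mem_range_map_iMap (F : BundleFunctor Λ) {α : Λ} {X Y : Mf} {g : X ⟶ Y}
    (hg : Mf.IsOpenEmb g) {y : F.tot.obj (iObj α Y)} :
    y ∈ Set.range (F.tot.map (iMap (le_refl α) g)).toFun ↔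
      (F.proj.app (iObj α Y)).toFun y ∈ Set.range g.toFun :=
  F.mem_range_map fun γ => hg.iMap α γ

theorem injective_map_iMap (F : BundleFunctor Λ) {α : Λ} {X Y : Mf} {g : X ⟶ Y}
    (hg : Mf.IsOpenEmb g) : Function.Injective (F.tot.map (iMap (le_refl α) g)).toFun :=
  (F.isOpenEmb_map fun γ => hg.iMap α γ).injective

/-- The compatibility condition which defines `∏_μ G_α (π)`. -/
def IsCompatible (F : BundleFunctor Λ) (π : MFib Λ) (x : ∀ α, F.tot.obj (iObj α (π.comp α))) :
    Prop :=
  ∀ {α β : Λ} (h : α ≤ β), (F.tot.map (iMap le_rfl (π.proj h))).toFun (x β) =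
    (F.tot.map (iMap h (𝟙 (π.comp α)))).toFun (x α)

section Model

variable {n : ℕ} (p : Fin n → Λ)

theorem modelProj_eq_theta (F : BundleFunctor Λ) (i : Fin n) :
    F.theta (model p) (p i) ≫ F.tot.map (iMap le_rfl (modelCoord p (p i) ⟨i, le_rfl⟩)) =
      F.tot.map (modelProj p i) := by
  rw [theta, ← F.tot.map_comp]
  rfl

theorem ProductPreserving.theta_injective_model (hF : F.ProductPreserving) :
    Function.Injective fun (y : F.tot.obj (model p)) α => (F.theta (model p) α).toFun y := by
  intro y z hyz
  refine (Mf.bijective_of_isProd (hF.isProd_model p)).1 (funext fun i => ?_)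
  have h := congrFun hyz (p i)
  simp only [← modelProj_eq_theta, Mf.comp_toFun]
  exact congrArg _ h

theorem ProductPreserving.locallyRetracts_theta_model (hF : F.ProductPreserving)
    (y : F.tot.obj (model p)) : Mf.LocallyRetracts (F.theta (model p)) y :=
  (Mf.locallyRetracts_of_isProd (hF.isProd_model p) y).of_factor p _
    fun i => modelProj_eq_theta p F i

/-- The point `y` is built from the components `x (p i)` alone. For `p i ≤ α`, compatibility carries
the `i`-th coordinate of `x (p i)` to that of `x α`, so the remaining components agree too. -/
theorem ProductPreserving.exists_theta_eq_model (hF : F.ProductPreserving)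
    {x : ∀ α, F.tot.obj (iObj α ((model p).comp α))} (hx : F.IsCompatible (model p) x) :
    ∃ y, ∀ α, (F.theta (model p) α).toFun y = x α := by
  obtain ⟨y, hy⟩ := (Mf.bijective_of_isProd (hF.isProd_model p)).2 fun i =>
    (F.tot.map (iMap le_rfl (modelCoord p (p i) ⟨i, le_rfl⟩))).toFun (x (p i))
  have hy' : ∀ i, (F.tot.map (modelProj p i)).toFun y =
      (F.tot.map (iMap le_rfl (modelCoord p (p i) ⟨i, le_rfl⟩))).toFun (x (p i)) := congrFun hy
  refine ⟨y, fun α => hF.eq_of_coord α (isProd_modelCoord p α) fun i => ?_⟩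
  have e : jMap (model p) α ≫ iMap le_rfl (modelCoord p α i) =
      modelProj p i.1 ≫ iMap i.2 (𝟙 Mf.Line) := iVal_injective (by
    rw [iVal_jMap_comp_iMap, iVal_comp_iMap, modelProj, iVal_iHom, Category.comp_id,
      (model p).proj_self, Category.id_comp, model_proj_coord])
  have h := hx i.2
  rw [theta, map_map, e, ← map_map, hy', map_map, iMap_comp, Category.comp_id,
    ← model_proj_coord p i.2 ⟨i.1, le_rfl⟩, ← iMap_comp le_rfl le_rfl, ← map_map, h, map_map,
    iMap_comp, Category.id_comp]

end Model

theorem proj_eq_of_theta_eq (F : BundleFunctor Λ) {π : MFib Λ} {y z : F.tot.obj π}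
    (h : ∀ α, (F.theta π α).toFun y = (F.theta π α).toFun z) :
    (F.proj.app π).toFun y = (F.proj.app π).toFun z :=
  π.total_ext fun α => by rw [← proj_theta, ← proj_theta, h]

theorem ProductPreserving.theta_injective (hF : F.ProductPreserving) (π : MFib Λ) :
    Function.Injective fun (y : F.tot.obj π) α => (F.theta π α).toFun y := by
  intro y z hyz
  have h : ∀ α, (F.theta π α).toFun y = (F.theta π α).toFun z := congrFun hyz
  obtain ⟨n, p, H⟩ := π.exists_openEmb_model
  obtain ⟨e, he, hr⟩ := H ((F.proj.app π).toFun y)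
  obtain ⟨y, rfl⟩ := (F.mem_range_map he).2 hr
  -- Equal images under all `F(j_α)` force equal base points, so both points come from the same copy
  -- of the model.
  obtain ⟨z, rfl⟩ := (F.mem_range_map he).2 (F.proj_eq_of_theta_eq h ▸ hr)
  refine congrArg _ (hF.theta_injective_model p (funext fun α => F.injective_map_iMap (he α) ?_))
  rw [← theta_map, ← theta_map, h]

/-- The retraction is transported from the model. Finiteness of `Λ` makes "every component lies over
the chart" an open condition in the product. -/
theorem ProductPreserving.locallyRetracts_theta [Finite Λ] (hF : F.ProductPreserving) (π : MFib Λ)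
    (y : F.tot.obj π) : Mf.LocallyRetracts (F.theta π) y := by
  obtain ⟨n, p, H⟩ := π.exists_openEmb_model
  obtain ⟨e, he, hr⟩ := H ((F.proj.app π).toFun y)
  obtain ⟨y, rfl⟩ := (F.mem_range_map he).2 hr
  refine (hF.locallyRetracts_theta_model p y).of_openEmb (F.tot.map e)
    (fun α => F.tot.map (iMap le_rfl (e.comp α)))
    (fun α => F.isOpenEmb_map fun γ => (he α).iMap α γ)
    (fun α => Mf.hom_ext fun y => F.theta_map e α y) fun z hz => (F.mem_range_map he).2 ?_
  refine e.mem_range_total (fun α => (he α).injective) _ fun α => ?_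
  rw [← proj_theta]
  exact (F.mem_range_map_iMap (he α)).1 (hz α)

theorem ProductPreserving.exists_theta_eq (hF : F.ProductPreserving) {π : MFib Λ}
    {x : ∀ α, F.tot.obj (iObj α (π.comp α))} (hx : F.IsCompatible π x) :
    ∃ y, ∀ α, (F.theta π α).toFun y = x α := by
  -- The base points of a compatible family form a point of the limit, and a chart around it
  -- contains the whole family.
  obtain ⟨b, hb, -⟩ := π.limit (fun α => (F.proj.app _).toFun (x α)) fun {α β} h => by
    have h1 := congrArg (F.proj.app _).toFun (hx h)
    rw [proj_map, proj_map] at h1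
    exact h1
  obtain ⟨n, p, H⟩ := π.exists_openEmb_model
  obtain ⟨e, he, w, rfl⟩ := H b
  have hr : ∀ α, x α ∈ Set.range (F.tot.map (iMap (le_refl α) (e.comp α))).toFun := fun α => by
    rw [F.mem_range_map_iMap (he α), ← hb α, e.can_total]
    exact ⟨_, rfl⟩
  choose x' hx' using hr
  -- The lifted family is compatible because the original one is and `F(i_β(e_α))` is injective.
  obtain ⟨y, hy⟩ := hF.exists_theta_eq_model p (x := x') fun {α β} h =>
    F.injective_map_iMap (he α) (by
      rw [map_map, iMap_comp, ← e.comm, ← iMap_comp le_rfl le_rfl, ← map_map, hx', hx h, ← hx' α,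
        map_map, map_map, iMap_comp, iMap_comp, Category.id_comp, Category.comp_id])
  exact ⟨(F.tot.map e).toFun y, fun α => by rw [theta_map, hy, hx']⟩

end BundleFunctor

/-! ### The diffeomorphism `κ`, and existence and uniqueness of `η` -/

namespace BundleFunctor

variable {F F' : BundleFunctor Λ}

theorem I_kappa (hF : F.ProductPreserving) (π : MFib Λ) (y : (F.functor.obj π).total) :
    I F.mu (F.pointPreserving_mu hF) π (F.kappa hF π y) = F.Theta π y :=
  Equiv.apply_symm_apply _ _

theorem ProductPreserving.Theta_bijective (hF : F.ProductPreserving) (π : MFib Λ) :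
    Function.Bijective (F.Theta π) := by
  refine ⟨fun y z h => hF.theta_injective π (congrArg Subtype.val h), fun x => ?_⟩
  obtain ⟨y, hy⟩ := hF.exists_theta_eq (π := π) (x := x.1) fun h => x.2 h
  exact ⟨y, Subtype.ext (funext hy)⟩

theorem ProductPreserving.kappaIsDiffeo [Finite Λ] (hF : F.ProductPreserving) (π : MFib Λ) :
    F.KappaIsDiffeo hF π where
  bijective := (I F.mu (F.pointPreserving_mu hF) π).symm.bijective.comp (hF.Theta_bijective π)
  embedding := by
    simp only [I_kappa]
    exact Mf.isEmbedding_of_locallyRetracts (hF.locallyRetracts_theta π) (hF.theta_injective π)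
  immersion y v hv := by
    have he : ∀ α, (fun z => (I F.mu (F.pointPreserving_mu hF) π (F.kappa hF π z)).1 α) =
        (F.theta π α).toFun := fun α => funext fun z =>
      congrFun (congrArg Subtype.val (I_kappa hF π z)) α
    -- The codomain of `mfderiv` is the tangent space at the image point, so it changes with the
    -- function; the equality is transported in this generality.
    have hc : ∀ {X Y : Mf} {f g : X → Y} (x : X) (w : TangentSpace (𝓡 X.dim) x), f = g →
        mfderiv (𝓡 X.dim) (𝓡 Y.dim) f x w = 0 → mfderiv (𝓡 X.dim) (𝓡 Y.dim) g x w = 0 := by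
      rintro X Y f _ x w rfl h
      exact h
    exact Mf.eq_zero_of_locallyRetracts (hF.locallyRetracts_theta π y) v
      fun α => hc y v (he α) (hv α)

/-- A natural transformation `G^F_α ⟶ G^{F'}_α` lies over the identity maps. -/
theorem nat_base {α : Λ} (t : F.mu.obj α ⟶ F'.mu.obj α) (X : Mf) (x : X) :
    (t.app X).base.toFun x = x :=
  -- Naturality along the constant map from the point with value `x`, read on base manifolds.
  congrArg (fun k => Mf.Hom.toFun (FM.Hom.base k) (0 : EuclideanSpace ℝ (Fin 0)))
    (t.naturality (Mf.const Mf.pt x))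

theorem nat_proj {α : Λ} (t : F.mu.obj α ⟶ F'.mu.obj α) (X : Mf) (y : F.tot.obj (iObj α X)) :
    (F'.proj.app (iObj α X)).toFun ((t.app X).total.toFun y) =
      (F.proj.app (iObj α X)).toFun y :=
  (congrArg (fun k => Mf.Hom.toFun k y) (t.app X).comm).trans (nat_base t X _)

theorem nat_map {α : Λ} (t : F.mu.obj α ⟶ F'.mu.obj α) {X Y : Mf} (f : X ⟶ Y)
    (y : F.tot.obj (iObj α X)) :
    (F'.tot.map (iMap (le_refl α) f)).toFun ((t.app X).total.toFun y) =
      (t.app Y).total.toFun ((F.tot.map (iMap (le_refl α) f)).toFun y) :=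
  nat_total t f y

section Eta

variable [Finite Λ] (hF : F.ProductPreserving) (hF' : F'.ProductPreserving)
  (ν : ∀ α : Λ, F.mu.obj α ⟶ F'.mu.obj α) (hν : Compatible ν)

/-- The map `η_π = κ'_π⁻¹ ∘ ν̃_π ∘ κ_π`. -/
def etaFun (π : MFib Λ) (y : F.tot.obj π) : F'.tot.obj π :=
  (Equiv.ofBijective (F'.kappa hF' π) (hF'.kappaIsDiffeo π).bijective).symm
    (nuTilde (F.pointPreserving_mu hF) (F'.pointPreserving_mu hF') ν @hν π (F.kappa hF π y))

/-- The bijections `I` cancel, leaving the formula that determines `η`; its further properties are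
derived from this one. -/
theorem theta_etaFun (π : MFib Λ) (y : F.tot.obj π) (α : Λ) :
    (F'.theta π α).toFun (etaFun hF hF' ν @hν π y) =
      ((ν α).app (π.comp α)).total.toFun ((F.theta π α).toFun y) := by
  have h1 : F'.kappa hF' π (etaFun hF hF' ν @hν π y) =
      nuTilde (F.pointPreserving_mu hF) (F'.pointPreserving_mu hF') ν @hν π (F.kappa hF π y) :=
    (Equiv.ofBijective (F'.kappa hF' π) (hF'.kappaIsDiffeo π).bijective).apply_symm_apply _
  have h2 := congrArg (I F'.mu (F'.pointPreserving_mu hF') π) h1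
  have h3 : F'.Theta π (etaFun hF hF' ν @hν π y) = nuProd ν @hν π (F.Theta π y) :=
    (I_kappa hF' π _).symm.trans (h2.trans ((Equiv.apply_symm_apply _ _).trans
      (congrArg (nuProd ν @hν π) (I_kappa hF π y))))
  exact congrFun (congrArg Subtype.val h3) α

theorem contMDiff_etaFun (π : MFib Λ) :
    ContMDiff (𝓡 (F.tot.obj π).dim) (𝓡 (F'.tot.obj π).dim) ∞
      (etaFun hF hF' ν @hν π) := by
  refine Mf.contMDiff_of_locallyRetracts (hF'.locallyRetracts_theta π) fun α => ?_
  simp only [theta_etaFun]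
  exact ((ν α).app (π.comp α)).total.smooth.comp (F.theta π α).smooth

theorem proj_etaFun (π : MFib Λ) (y : F.tot.obj π) :
    (F'.proj.app π).toFun (etaFun hF hF' ν @hν π y) = (F.proj.app π).toFun y :=
  π.total_ext fun α => by
    rw [← proj_theta, theta_etaFun, nat_proj, proj_theta]

theorem etaFun_map {π ρ : MFib Λ} (f : π ⟶ ρ) (y : F.tot.obj π) :
    etaFun hF hF' ν @hν ρ ((F.tot.map f).toFun y) =
      (F'.tot.map f).toFun (etaFun hF hF' ν @hν π y) :=
  hF'.theta_injective ρ (funext fun α => by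
    simp only
    rw [theta_etaFun, theta_map, theta_map, theta_etaFun, nat_map])

/-- The natural transformation `η`. -/
def eta : F.functor ⟶ F'.functor where
  app π := ⟨⟨etaFun hF hF' ν @hν π, contMDiff_etaFun hF hF' ν @hν π⟩, 𝟙 _,
    Mf.hom_ext fun y => proj_etaFun hF hF' ν @hν π y⟩
  naturality _ _ f := FM.hom_ext (Mf.hom_ext fun y => etaFun_map hF hF' ν @hν f y)
    ((Category.comp_id _).trans (Category.id_comp _).symm)

/-- Compare the components under `F'(j_β)`. Unless `α ≤ β` they lie in a point; otherwise `j_β`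
becomes `id^α_β`, and the equality is the compatibility of `ν` with the two inductive systems. -/
theorem etaFun_iObj (α : Λ) (X : Mf) (y : F.tot.obj (iObj α X)) :
    etaFun hF hF' ν @hν (iObj α X) y = ((ν α).app X).total.toFun y := by
  refine hF'.theta_injective (iObj α X) (funext fun β => ?_)
  simp only [theta_etaFun]
  refine eq_of_outSel (F'.mu.obj β) (F'.pointPreserving_mu hF' β) fun hb => ?_
  have h : α ≤ β := leB_iff.1 hb
  have h1 : ∀ (G : BundleFunctor Λ) (z : G.tot.obj (iObj α X)),
      (G.tot.map (iMap le_rfl (iOut α X h))).toFun ((G.theta (iObj α X) β).toFun z) =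
        (G.tot.map (iMap h (𝟙 X))).toFun z := fun G z => by
    rw [theta, map_map, jMap_comp_iMap_iOut]
  have h2 := nat_map (ν β) (iOut α X h) ((F.theta (iObj α X) β).toFun y)
  rw [h1] at h2
  refine h2.trans (Eq.trans ?_ (h1 F' (((ν α).app X).total.toFun y)).symm)
  exact (congrArg (fun k => Mf.Hom.toFun (FM.Hom.total k) y) (hν h X)).symm

theorem nuOf_eta (α : Λ) : nuOf (eta hF hF' ν @hν) α = ν α := by
  refine NatTrans.ext (funext fun X => FM.hom_ext (Mf.hom_ext fun y => ?_)
    (Mf.hom_ext fun x => ?_))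
  · exact etaFun_iObj hF hF' ν @hν α X y
  · exact (nat_base (ν α) X x).symm

end Eta

/-- A natural transformation is determined by its values at the multifibered manifolds
`i_α(X)`. -/
theorem ProductPreserving.natTrans_ext (hF' : F'.ProductPreserving) {η η' : F.functor ⟶ F'.functor}
    (h : ∀ α, nuOf η α = nuOf η' α) : η = η' := by
  have key : ∀ (ζ : F.functor ⟶ F'.functor) (π : MFib Λ) (α : Λ) (y : F.tot.obj π),
      (F'.theta π α).toFun ((ζ.app π).total.toFun y) =
        ((nuOf ζ α).app (π.comp α)).total.toFun ((F.theta π α).toFun y) := fun ζ π α y =>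
    (congrArg (fun k : F.functor.obj π ⟶ F'.functor.obj (iObj α (π.comp α)) =>
      Mf.Hom.toFun (FM.Hom.total k) y) (ζ.naturality (jMap π α))).symm
  refine NatTrans.ext (funext fun π => ?_)
  have ht : (η.app π).total = (η'.app π).total := Mf.hom_ext fun y =>
    hF'.theta_injective π (funext fun α => by
      refine (key η π α y).trans (Eq.trans ?_ (key η' π α y).symm)
      rw [h])
  refine FM.hom_ext ht (Mf.hom_ext fun x => ?_)
  -- The bundle projection is onto, so the map of total spaces determines the base map.
  obtain ⟨y, rfl⟩ := (F.functor.obj π).isSurjSubmersion.surjective x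
  have h1 := (η.app π).comm
  rw [ht, (η'.app π).comm] at h1
  exact (congrArg (fun k => Mf.Hom.toFun k y) h1).symm

end BundleFunctor

end Multifibered

end

theorem proposition3p3 {Λ : Type} [PartialOrder Λ] [Finite Λ] (F F' : BundleFunctor Λ)
    (hF : F.ProductPreserving) (hF' : F'.ProductPreserving)
    (ν : ∀ α : Λ, F.mu.obj α ⟶ F'.mu.obj α) (hν : Compatible ν) :
    ∃ hκ : ∀ π : MFib Λ, F'.KappaIsDiffeo hF' π,
      ∃ η : F.functor ⟶ F'.functor,
        (∀ (π : MFib Λ) (y : (F.functor.obj π).total),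
          (η.app π).total.toFun y =
            (Equiv.ofBijective (F'.kappa hF' π) (hκ π).bijective).symm
              (nuTilde (F.pointPreserving_mu hF) (F'.pointPreserving_mu hF') ν hν π
                (F.kappa hF π y))) ∧
        (∀ α, BundleFunctor.nuOf η α = ν α) ∧
        ∀ η' : F.functor ⟶ F'.functor, (∀ α, BundleFunctor.nuOf η' α = ν α) → η' = η := by
  refine ⟨fun π => hF'.kappaIsDiffeo π, BundleFunctor.eta hF hF' ν @hν, fun _ _ => rfl,
    BundleFunctor.nuOf_eta hF hF' ν @hν, fun η' h => hF'.natTrans_ext fun α => ?_⟩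
  rw [h, BundleFunctor.nuOf_eta]
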